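/- **Setting.** Let $n$ players have strategy sets $\mathcal X_i\subset\mathbb R^{d_i}$, $d_i\ge 1$, put $d=\sum_i d_i$, $\mathcal X=\mathcal X_1\times\dots\times\mathcal X_n\subset\mathbb R^d$, and let $f_i:\mathcal X\to\mathbb R$ be the cost of player $i$. Let $\mathbb S_i,\mathbb B_i$ be the unit sphere and unit ball of $\mathbb R^{d_i}$; norms are Euclidean. Assume there are constants $\alpha>0$, $\beta,L\ge 0$, $r,R>0$ such that: (a) each $\mathcal X_i$ is closed and convex, and $r\mathbb B\subseteq\mathcal X\subseteq R\mathbb B$, where $\mathbb B$ is the unit ball of $\mathbb R^d$; (b) each $f_i$ is convex and $C^1$ in $x_i$, and the partial gradient $x\mapsto\nabla_i f_i(x)$ is $\beta$-Lipschitz on $\mathcal X$; (c) each map $x\mapsto\nabla_i f_i(x)$ is differentiable on $\mathcal X$ and its Jacobian is $L$-Lipschitz on $\mathcal X$ in operator norm; (d) $g=(\nabla_1f_1,\dots,\nabla_nf_n)$ is $\alpha$-strongly monotone on $\mathcal X$: $\langle g(x)-g(x'),x-x'\rangle\ge\alpha\|x-x'\|^2$ for all $x,x'\in\mathcal X$;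 (e) each $f_i$ is Borel measurable and bounded on $\mathcal X$; put $F_*=\max_i\sup_{x\in\mathcal X}|f_i(x)|^2$. A Nash equilibrium of a game with costs $h_i$ over $\prod_i K_i$ is a point $x\in\prod_i K_i$ such that, for each $i$, $x_i$ minimizes $h_i(\cdot,x_{-i})$ over $K_i$. Let $0<\delta\le\min\{1,r\}$ and $2Ln^{3/2}\delta\le\alpha$ (that is, $\delta\le\frac{\alpha}{2Ln^{3/2}}$ if $L>0$). Assume that the queried strategies are feasible: $y+\delta u\in\mathcal X_i$ for all $i$, $y\in(1-\delta)\mathcal X_i$ and $u\in\mathbb S_i$ (equivalently, $\mathbb B_i\subseteq\mathcal X_i$ for all $i$). For $x\in(1-\delta)\mathcal X$ let $f_i^\delta(x)=\mathbb E\, f_i(x+\delta w)$, where $w$ is uniformly distributed on $\mathbb B_i\times\prod_{j\ne i}\mathbb S_j$. **Algorithm.** Start from a deterministic $x^1\in(1-\delta)\mathcal X$, and let $\eta_t=\frac{2}{\alpha t}$. For $t=1,2,\dots$ sample $v_i^t$ uniformly from $\mathbb S_i$, independently over all $i$ and $t$, and set $$\hat g_i^t=\frac{d_i}{\delta}f_i(x^t+\delta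 v^t)\,v_i^t,\qquad x_i^{t+1}=\mathrm{proj}_{(1-\delta)\mathcal X_i}\bigl(x_i^t-\eta_t\hat g_i^t\bigr)\qquad(i=1,\dots,n).$$ **Theorem.** The game with costs $f_i$ over $\mathcal X$ has a unique Nash equilibrium $x^\star$, the game with costs $f_i^\delta$ over $(1-\delta)\mathcal X$ has a unique Nash equilibrium $x^\star_\delta$, and for every $t\ge 1$ the expectation below is finite and $$\mathbb E\|x^t-x^\star\|^2\le\frac{\max\{\delta^2\alpha^2\|x^1-x^\star_\delta\|^2,\;8F_*d^2n\}}{\delta^2\alpha^2t}+2\delta^2\left(\Bigl(1+\frac{\beta\sqrt n}{\alpha}\Bigr)\|x^\star\|+\frac{\beta n}{\alpha}\right)^2 .$$ -/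

import Mathlib

open MeasureTheory ProbabilityTheory Metric
open scoped Pointwise

noncomputable section

namespace DFGame

/-- Strategy profiles `x = (x_1, …, x_n)` with `x_i ∈ ℝ^{d_i}`, i.e. the Euclidean space `ℝ^d`
with `d = ∑ i, d_i`, split into its `n` blocks. -/
abbrev Profile {n : ℕ} (d : Fin n → ℕ) : Type :=
  PiLp 2 (fun i : Fin n => EuclideanSpace ℝ (Fin (d i)))

variable {n : ℕ} {d : Fin n → ℕ}

/-- The profile `(y, x_{-i})`. -/
def deviate (x : Profile d) (i : Fin n) (y : EuclideanSpace ℝ (Fin (d i))) : Profile d :=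
  WithLp.toLp 2 (Function.update (fun j => x j) i y)

/-- The product `X_1 × ⋯ × X_n`. -/
def prodSet (X : ∀ i : Fin n, Set (EuclideanSpace ℝ (Fin (d i)))) : Set (Profile d) :=
  {x | ∀ i, x i ∈ X i}

/-- `x` is a Nash equilibrium of the game with strategy sets `X i` and costs `f i`. -/
def IsNash (X : ∀ i : Fin n, Set (EuclideanSpace ℝ (Fin (d i))))
    (f : Fin n → Profile d → ℝ) (x : Profile d) : Prop :=
  x ∈ prodSet X ∧ ∀ i, ∀ y ∈ X i, f i x ≤ f i (deviate x i y)

/-- The partial gradient `∇_i f_i(x)`, taken relative to `X i` (only the values of the costs on the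
product of the strategy sets matter; at interior points this is the usual partial gradient). -/
def partialGrad (X : ∀ i : Fin n, Set (EuclideanSpace ℝ (Fin (d i))))
    (f : Fin n → Profile d → ℝ) (i : Fin n) (x : Profile d) : EuclideanSpace ℝ (Fin (d i)) :=
  gradientWithin (fun y => f i (deviate x i y)) (X i) (x i)

/-- The map `g(x) = (∇_1 f_1(x), …, ∇_n f_n(x))`. -/
def gameGrad (X : ∀ i : Fin n, Set (EuclideanSpace ℝ (Fin (d i))))
    (f : Fin n → Profile d → ℝ) (x : Profile d) : Profile d :=
  WithLp.toLp 2 (fun i => partialGrad X f i x)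

/-- The standing assumptions on the game. -/
structure Standing (X : ∀ i : Fin n, Set (EuclideanSpace ℝ (Fin (d i))))
    (f : Fin n → Profile d → ℝ) (α β L r R : ℝ) : Prop where
  alpha_pos : 0 < α
  beta_nonneg : 0 ≤ β
  L_nonneg : 0 ≤ L
  r_pos : 0 < r
  R_pos : 0 < R
  isClosed : ∀ i, IsClosed (X i)
  convex : ∀ i, Convex ℝ (X i)
  ball_subset : closedBall (0 : Profile d) r ⊆ prodSet X
  subset_ball : prodSet X ⊆ closedBall (0 : Profile d) R
  /-- `f_i` is convex in `x_i`. -/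
  convexOn : ∀ i, ∀ x ∈ prodSet X, ConvexOn ℝ (X i) (fun y => f i (deviate x i y))
  /-- `f_i` is differentiable in `x_i` (and `C^1` in `x_i`, by the next item). -/
  differentiable : ∀ i, ∀ x ∈ prodSet X,
    DifferentiableOn ℝ (fun y => f i (deviate x i y)) (X i)
  /-- `∇_i f_i` is `β`-Lipschitz in the whole profile. -/
  grad_lipschitz : ∀ i, ∀ x ∈ prodSet X, ∀ x' ∈ prodSet X,
    ‖partialGrad X f i x - partialGrad X f i x'‖ ≤ β * ‖x - x'‖
  /-- `∇_i f_i` has a Jacobian, which is `L`-Lipschitz in operator norm. -/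
  grad_differentiable : ∀ i, DifferentiableOn ℝ (partialGrad X f i) (prodSet X)
  jacobian_lipschitz : ∀ i, ∀ x ∈ prodSet X, ∀ x' ∈ prodSet X,
    ‖fderivWithin ℝ (partialGrad X f i) (prodSet X) x
      - fderivWithin ℝ (partialGrad X f i) (prodSet X) x'‖ ≤ L * ‖x - x'‖
  /-- `g` is `α`-strongly monotone. -/
  strongly_monotone : ∀ x ∈ prodSet X, ∀ x' ∈ prodSet X,
    α * ‖x - x'‖ ^ 2 ≤ inner ℝ (gameGrad X f x - gameGrad X f x') (x - x')
  /-- The costs are measurable and bounded on the product set. -/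
  measurable : ∀ i, Measurable (fun x : prodSet X => f i x)
  bounded : ∀ i, BddAbove (Set.range (fun x : prodSet X => |f i x| ^ 2))

/-- `F_* = max_i sup_{x ∈ X} |f_i(x)|^2`. -/
def Fstar (X : ∀ i : Fin n, Set (EuclideanSpace ℝ (Fin (d i))))
    (f : Fin n → Profile d → ℝ) : ℝ :=
  ⨆ i, ⨆ x : prodSet X, |f i x| ^ 2

/-- The uniform distribution on the unit sphere of `ℝ^m` (normalized surface measure), as a measure
on `ℝ^m`. -/
def unifSphere (m : ℕ) : Measure (EuclideanSpace ℝ (Fin m)) :=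
  (ProbabilityTheory.cond (volume : Measure (EuclideanSpace ℝ (Fin m))).toSphere Set.univ).map
    Subtype.val

/-- The uniform distribution on the unit ball of `ℝ^m`. -/
def unifBall (m : ℕ) : Measure (EuclideanSpace ℝ (Fin m)) :=
  ProbabilityTheory.cond volume (closedBall 0 1)

/-- The uniform distribution `U_i` on `𝔹_i × ∏_{j ≠ i} 𝕊_j`. -/
def smoothingLaw (d : Fin n → ℕ) (i : Fin n) :
    Measure (∀ j : Fin n, EuclideanSpace ℝ (Fin (d j))) :=
  Measure.pi (fun j => if j = i then unifBall (d j) else unifSphere (d j))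

/-- The smoothed costs `f_i^δ(x) = E_{w ∼ U_i} f_i(x + δ w)`. -/
def smoothed (f : Fin n → Profile d → ℝ) (δ : ℝ) (i : Fin n) (x : Profile d) : ℝ :=
  ∫ w, f i (x + δ • WithLp.toLp 2 w) ∂(smoothingLaw d i)

/-- The metric projection onto `K`: the point of `K` nearest to `u`. -/
def metricProj {E : Type*} [NormedAddCommGroup E] (K : Set E) (u : E) : E :=
  Classical.epsilon (fun p => p ∈ K ∧ ∀ y ∈ K, ‖u - p‖ ≤ ‖u - y‖)

/-- The single-point estimate `ĝ_i = (d_i / δ) f_i(x + δ v) v_i`. -/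
def gradEstimate (f : Fin n → Profile d → ℝ) (δ : ℝ) (x v : Profile d) (i : Fin n) :
    EuclideanSpace ℝ (Fin (d i)) :=
  (((d i : ℝ) / δ) * f i (x + δ • v)) • v i

/-- One round: every player `i` moves to `proj_{(1-δ)X_i}(x_i - η ĝ_i)`. -/
def step (X : ∀ i : Fin n, Set (EuclideanSpace ℝ (Fin (d i))))
    (f : Fin n → Profile d → ℝ) (δ η : ℝ) (x v : Profile d) : Profile d :=
  WithLp.toLp 2 (fun i => metricProj ((1 - δ) • X i) (x i - η • gradEstimate f δ x v i))

/-- The iterates `x^t`, `t ≥ 1`, of derivative-free gradient play started at `x^1 = x₁`, with step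
sizes `η t` and sampled directions `v t`. (The value at index `0` is a dummy.) -/
def iterates (X : ∀ i : Fin n, Set (EuclideanSpace ℝ (Fin (d i))))
    (f : Fin n → Profile d → ℝ) (δ : ℝ) (η : ℕ → ℝ) (x₁ : Profile d) (v : ℕ → Profile d) :
    ℕ → Profile d
  | 0 => x₁
  | t + 1 => if t = 0 then x₁ else step X f δ (η t) (iterates X f δ η x₁ v t) (v t)

end DFGame

end

/-! Both equilibria solve variational inequalities: that of `gameGrad` over X, and that of
`smoothGrad` over (1-δ)X, where the i-th block of `smoothGrad` is the mean of ∇_i f_i(x + δw). A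
strongly monotone Lipschitz field has exactly one solution (`exists_isVISol`, `IsVISol.unique`).
Smoothing changes differences of the field by at most Lnδ‖x-y‖, so strong monotonicity survives with
constant α/2 (`strongly_monotone_smoothGrad`).

The estimate ĝ_i is unbiased for block i of `smoothGrad` (`integral_cost_mul_inner`): with the other
coordinates frozen, the divergence theorem turns a ball average of ∇_i f_i into a sphere average of
(d_i/δ) f_i v_i. Projections are nonexpansive and ‖ĝ_i‖² ≤ d_i² F_*/δ², so e_t = E‖x^t - x*_δ‖²
satisfies e_{t+1} ≤ (1-2/t) e_t + Q/t² with Q = 4F_*d²/(δ²α²). Testing each variational inequality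
against the other's solution bounds ‖x*_δ - x*‖ by a multiple of δ (`norm_equilibrium_sub_le`), and
(a+b)² ≤ 2a² + 2b² joins the two estimates.

It remains to have e_t ≤ Qn/t. The recursion gives Q/t for t ≥ 3, but only Q at t = 2 and nothing at
t = 1. These cases rest on the size of the shrunk sets: bounded costs and strong convexity give
αδ‖y-z‖ ≤ 2√F_* for each player (`norm_sub_le_sqrt_Fstar`). A single player on a line at t = 2 needs
the sharper `norm_sub_equilibrium_le_of_dim_eq_one`. The second entry of the maximum therefore
always suffices. -/

noncomputable section

namespace DFGame

/-! ### The divergence theorem on the unit ball for Lipschitz functions -/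

section Divergence

open Filter Topology

theorem abs_inner_div_norm_le {E : Type*} [NormedAddCommGroup E] [InnerProductSpace ℝ E]
    (x v : E) : |inner ℝ x v / ‖x‖| ≤ ‖v‖ := by
  rw [abs_div, abs_norm]
  rcases eq_or_ne x 0 with rfl | hx
  · simp
  · rw [div_le_iff₀ (norm_pos_iff.2 hx), mul_comm]
    exact abs_real_inner_le_norm x v

variable {E : Type*} [NormedAddCommGroup E] [InnerProductSpace ℝ E] [FiniteDimensional ℝ E]
  [MeasurableSpace E] [BorelSpace E] (μ : Measure E) [μ.IsAddHaarMeasure]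

/-- Dilation preserves directions, so only the volume factor changes. -/
theorem setIntegral_ball_comp_direction_scale (G : E → ℝ) {ρ : ℝ} (hρ : 0 < ρ) :
    ∫ x in ball (0 : E) ρ, G (‖x‖⁻¹ • x) ∂μ
      = ρ ^ Module.finrank ℝ E * ∫ x in ball (0 : E) 1, G (‖x‖⁻¹ • x) ∂μ := by
  have h := Measure.setIntegral_comp_smul μ (fun x => G (‖x‖⁻¹ • x)) (ball (0 : E) 1) hρ.ne'
  have h2 : ∀ x : E, ‖ρ • x‖⁻¹ • ρ • x = ‖x‖⁻¹ • x := by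
    intro x
    rw [norm_smul, Real.norm_of_nonneg hρ.le, smul_smul, mul_inv, mul_right_comm,
      inv_mul_cancel₀ hρ.ne', one_mul]
  have h3 : ρ • ball (0 : E) 1 = ball 0 ρ := by
    rw [smul_unitBall hρ.ne', Real.norm_of_nonneg hρ.le]
  simp only [h2, h3, smul_eq_mul] at h
  rw [h, abs_of_pos (by positivity), mul_inv_cancel_left₀ (by positivity)]

variable [Nontrivial E]

/-- The integral over the unit ball of a function of the direction `x / ‖x‖`. -/
theorem setIntegral_ball_comp_direction (G : E → ℝ) :
    ∫ x in ball (0 : E) 1, G (‖x‖⁻¹ • x) ∂μ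
      = (Module.finrank ℝ E : ℝ)⁻¹ * ∫ u : sphere (0 : E) 1, G u ∂μ.toSphere := by
  have hpos : 0 < Module.finrank ℝ E := Module.finrank_pos
  have hmp := μ.measurePreserving_homeomorphUnitSphereProd
  -- In polar coordinates the integrand splits into a function on the sphere and the indicator of
  -- radii below 1; the radial factor is ∫₀¹ r^(m-1) dr = 1/m, with m the dimension.
  set φ : sphere (0 : E) 1 × Set.Ioi (0 : ℝ) → ℝ :=
    fun p => G p.1 * (Set.Iio (⟨1, Set.mem_Ioi.2 one_pos⟩ : Set.Ioi (0 : ℝ))).indicator (fun _ => (1 : ℝ)) p.2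
    with hφ
  have h1 : ∫ x in ball (0 : E) 1, G (‖x‖⁻¹ • x) ∂μ
      = ∫ x : ({0}ᶜ : Set E), φ (homeomorphUnitSphereProd E x) ∂(μ.comap (↑)) := by
    have h2 : ∀ x : ({0}ᶜ : Set E), φ (homeomorphUnitSphereProd E x)
        = (ball (0 : E) 1).indicator (fun x => G (‖x‖⁻¹ • x)) x := by
      intro x
      simp only [hφ, Set.indicator_apply, Set.mem_Iio, ← Subtype.coe_lt_coe,
        homeomorphUnitSphereProd_apply_snd_coe, homeomorphUnitSphereProd_apply_fst_coe]
      split_ifs with h <;> simp_all [Set.indicator_apply]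
    simp_rw [h2]
    rw [integral_subtype_comap (measurableSet_singleton (0 : E)).compl
      (fun x => (ball (0 : E) 1).indicator (fun x => G (‖x‖⁻¹ • x)) x),
      restrict_compl_singleton, integral_indicator measurableSet_ball]
  rw [h1, hmp.integral_comp (Homeomorph.measurableEmbedding _) φ, hφ,
    integral_prod_mul (fun u : sphere (0 : E) 1 => G u)
      (fun r => (Set.Iio (⟨1, Set.mem_Ioi.2 one_pos⟩ : Set.Ioi (0 : ℝ))).indicator (fun _ => (1 : ℝ)) r),
    integral_indicator measurableSet_Iio, mul_comm]
  congr 1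
  simp only [integral_const, smul_eq_mul, mul_one, measureReal_def, Measure.restrict_apply_univ]
  rw [Measure.volumeIoiPow_apply_Iio, ENNReal.toReal_ofReal (by positivity)]
  have : ((Module.finrank ℝ E - 1 : ℕ) : ℝ) + 1 = Module.finrank ℝ E := by
    exact_mod_cast Nat.sub_add_cancel hpos
  simp [this]

/-- The cone function `x ↦ max 0 (ρ - ‖x‖)`. -/
def coneFun {E : Type*} [NormedAddCommGroup E] (ρ : ℝ) (x : E) : ℝ := max 0 (ρ - ‖x‖)

theorem lipschitzWith_coneFun {E : Type*} [NormedAddCommGroup E] (ρ : ℝ) :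
    LipschitzWith 1 (coneFun ρ : E → ℝ) := by
  refine LipschitzWith.of_dist_le_mul fun x y => ?_
  rw [NNReal.coe_one, one_mul, Real.dist_eq, dist_eq_norm]
  have h1 := abs_max_sub_max_le_max 0 (ρ - ‖x‖) 0 (ρ - ‖y‖)
  rw [sub_self, abs_zero, max_eq_right (a := (0 : ℝ)) (abs_nonneg _), sub_sub_sub_cancel_left] at h1
  exact h1.trans (norm_sub_rev x y ▸ abs_norm_sub_norm_le y x)

theorem coneFun_of_le {E : Type*} [NormedAddCommGroup E] {ρ : ℝ} {x : E} (h : ρ ≤ ‖x‖) :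
    coneFun ρ x = 0 := max_eq_left (by linarith)

theorem coneFun_of_ge {E : Type*} [NormedAddCommGroup E] {ρ : ℝ} {x : E} (h : ‖x‖ ≤ ρ) :
    coneFun ρ x = ρ - ‖x‖ := max_eq_right (by linarith)

theorem hasCompactSupport_coneFun {E : Type*} [NormedAddCommGroup E] [ProperSpace E] (ρ : ℝ) :
    HasCompactSupport (coneFun ρ : E → ℝ) := by
  refine HasCompactSupport.intro (isCompact_closedBall (0 : E) ρ) fun x hx => coneFun_of_le ?_
  simpa using (not_le.1 (by simpa using hx) : ρ < ‖x‖).le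

theorem hasLineDerivAt_norm {E : Type*} [NormedAddCommGroup E] [InnerProductSpace ℝ E]
    {x : E} (hx : x ≠ 0) (v : E) :
    HasLineDerivAt ℝ (fun y : E => ‖y‖) (inner ℝ x v / ‖x‖) x v := by
  have h1 : HasDerivAt (fun t : ℝ => x + t • v) v 0 := by
    simpa using ((hasDerivAt_id (0 : ℝ)).smul_const v).const_add x
  have h2 := h1.norm_sq.sqrt (by simpa using hx)
  simp only [Real.sqrt_sq (norm_nonneg _), zero_smul, add_zero] at h2
  rwa [mul_div_mul_left _ _ two_ne_zero] at h2

theorem lineDeriv_coneFun_of_lt {E : Type*} [NormedAddCommGroup E] [InnerProductSpace ℝ E]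
    {ρ : ℝ} {x : E} (hx : x ≠ 0) (h : ‖x‖ < ρ) (v : E) :
    lineDeriv ℝ (coneFun ρ) x (-v) = inner ℝ x v / ‖x‖ := by
  have h1 : coneFun ρ =ᶠ[𝓝 x] fun y => ρ - ‖y‖ := by
    filter_upwards [(continuous_norm.tendsto x).eventually (gt_mem_nhds h)] with y hy
    exact coneFun_of_ge (le_of_lt hy)
  rw [h1.lineDeriv_eq]
  have h2 : HasLineDerivAt ℝ (fun y : E => ρ - ‖y‖) (-(inner ℝ x (-v) / ‖x‖)) x (-v) :=
    HasDerivAt.const_sub ρ (hasLineDerivAt_norm hx (-v))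
  rw [h2.lineDeriv, inner_neg_right, neg_div, neg_neg]

theorem lineDeriv_coneFun_of_gt {E : Type*} [NormedAddCommGroup E] [InnerProductSpace ℝ E]
    {ρ : ℝ} {x : E} (h : ρ < ‖x‖) (v : E) : lineDeriv ℝ (coneFun ρ) x v = 0 := by
  have h1 : coneFun ρ =ᶠ[𝓝 x] fun _ => (0 : ℝ) := by
    filter_upwards [(continuous_norm.tendsto x).eventually (lt_mem_nhds h)] with y hy
    exact coneFun_of_le (le_of_lt hy)
  rw [h1.lineDeriv_eq]
  exact (hasDerivAt_const (0 : ℝ) (0 : ℝ)).deriv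

/-- Integration by parts moves the derivative onto the cone, whose gradient is -x/‖x‖ inside the
ball of radius ρ and 0 outside; the origin and the sphere of radius ρ are null. -/
theorem integral_lineDeriv_mul_coneFun {h : E → ℝ} {C : NNReal} (hh : LipschitzWith C h) (v : E)
    (ρ : ℝ) :
    ∫ x, lineDeriv ℝ h x v * coneFun ρ x ∂μ
      = ∫ x in ball (0 : E) ρ, h x * (inner ℝ x v / ‖x‖) ∂μ := by
  rw [hh.integral_lineDeriv_mul_eq (lipschitzWith_coneFun ρ) (hasCompactSupport_coneFun ρ) v,
    ← integral_indicator measurableSet_ball]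
  refine integral_congr_ae ?_
  have h0 : ∀ᵐ x : E ∂μ, x ≠ 0 := by simp [ae_iff]
  have h1 : ∀ᵐ x : E ∂μ, x ∉ sphere (0 : E) ρ := by
    rw [ae_iff]
    simp only [not_not]
    exact Measure.addHaar_sphere μ 0 ρ
  filter_upwards [h0, h1] with x hx0 hx1
  simp only [mem_sphere_zero_iff_norm] at hx1
  rcases lt_or_gt_of_ne hx1 with hlt | hgt
  · rw [lineDeriv_coneFun_of_lt hx0 hlt, Set.indicator_of_mem (by simpa using hlt), mul_comm]
  · rw [lineDeriv_coneFun_of_gt hgt, Set.indicator_of_notMem (by simpa using hgt.le), zero_mul]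

/-- The divergence theorem on the unit ball, for a Lipschitz function. -/
theorem setIntegral_ball_lineDeriv {h : E → ℝ} {C : NNReal} (hh : LipschitzWith C h) (v : E) :
    ∫ x in ball (0 : E) 1, lineDeriv ℝ h x v ∂μ
      = ∫ u : sphere (0 : E) 1, h u * inner ℝ (u : E) v ∂μ.toSphere := by
  set m := Module.finrank ℝ E with hm
  have hpos : 0 < m := Module.finrank_pos
  set F : E → ℝ := fun x => h x * (inner ℝ x v / ‖x‖) with hF
  set G : E → ℝ := fun x => h x * inner ℝ x v with hG
  set H : E → ℝ := fun x => G (‖x‖⁻¹ • x) with hH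
  set I : ℝ := ∫ x in ball (0 : E) 1, H x ∂μ with hI
  have hHeq : ∀ x, H x = h (‖x‖⁻¹ • x) * (inner ℝ x v / ‖x‖) := by
    intro x
    simp only [hH, hG, real_inner_smul_left]
    ring
  have hbd : ∀ x : E, ‖x‖ ≤ 1 → |h x| ≤ |h 0| + C := by
    intro x hx
    have h1 := hh.dist_le_mul x 0
    rw [dist_zero_right, Real.dist_eq] at h1
    have h2 := abs_sub_abs_le_abs_sub (h x) (h 0)
    have h3 : (C : ℝ) * ‖x‖ ≤ C := mul_le_of_le_one_right C.coe_nonneg hx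
    linarith
  have hdir : ∀ x : E, ‖‖x‖⁻¹ • x‖ ≤ 1 := by
    intro x
    rw [norm_smul, norm_inv, norm_norm]
    exact inv_mul_le_one_of_le₀ le_rfl (norm_nonneg _)
  have hvm : Measurable fun x : E => inner ℝ x v / ‖x‖ := by fun_prop
  have hFm : Measurable F := hh.continuous.measurable.mul hvm
  have hHm : Measurable H := by
    have : H = fun x => h (‖x‖⁻¹ • x) * (inner ℝ x v / ‖x‖) := funext hHeq
    rw [this]
    exact (hh.continuous.measurable.comp (by fun_prop)).mul hvm
  have hFi : IntegrableOn F (ball 0 1) μ := by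
    refine Measure.integrableOn_of_bounded (M := (|h 0| + C) * ‖v‖) measure_ball_lt_top.ne
      hFm.aestronglyMeasurable ?_
    filter_upwards [ae_restrict_mem measurableSet_ball] with x hx
    rw [hF, Real.norm_eq_abs, abs_mul]
    exact mul_le_mul (hbd x (by simpa using (mem_ball_zero_iff.1 hx).le))
      (abs_inner_div_norm_le x v) (abs_nonneg _) (by positivity)
  have hHi : IntegrableOn H (ball 0 1) μ := by
    refine Measure.integrableOn_of_bounded (M := (|h 0| + C) * ‖v‖) measure_ball_lt_top.ne
      hHm.aestronglyMeasurable (.of_forall fun x => ?_)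
    rw [hHeq, Real.norm_eq_abs, abs_mul]
    exact mul_le_mul (hbd _ (hdir x)) (abs_inner_div_norm_le x v) (abs_nonneg _) (by positivity)
  have hdm : Measurable fun x => lineDeriv ℝ h x v := measurable_lineDeriv hh.continuous
  have hdb : ∀ x, ‖lineDeriv ℝ h x v‖ ≤ C * ‖v‖ :=
    fun x => norm_lineDeriv_le_of_lipschitz ℝ hh
  have hci : ∀ ρ, Integrable (fun x => lineDeriv ℝ h x v * coneFun ρ x) μ := by
    intro ρ
    exact (((lipschitzWith_coneFun (E := E) ρ).continuous.integrable_of_hasCompactSupport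
      (hasCompactSupport_coneFun ρ)).bdd_mul hdm.aestronglyMeasurable (.of_forall hdb))
  -- The weight is 1 on the ball of radius 1-ε and falls linearly to 0 at radius 1. As ε → 0 it
  -- becomes the indicator of the ball, while integration by parts leaves only the shell of width ε.
  set A : ℝ → ℝ := fun ε =>
    ∫ x, lineDeriv ℝ h x v * ((coneFun 1 x - coneFun (1 - ε) x) / ε) ∂μ with hA
  have hA1 : Tendsto A (𝓝[>] 0) (𝓝 (∫ x in ball (0 : E) 1, lineDeriv ℝ h x v ∂μ)) := by
    rw [← integral_indicator measurableSet_ball]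
    refine tendsto_integral_filter_of_dominated_convergence
      ((ball (0 : E) 1).indicator fun _ => C * ‖v‖) (.of_forall fun ε => ?_) ?_ ?_ ?_
    · exact (hdm.mul (((lipschitzWith_coneFun 1).continuous.sub
        (lipschitzWith_coneFun (1 - ε)).continuous).div_const ε).measurable).aestronglyMeasurable
    · filter_upwards [self_mem_nhdsWithin] with ε hε
      refine .of_forall fun x => ?_
      have hε' : (0 : ℝ) < ε := hε
      by_cases hx : x ∈ ball (0 : E) 1
      · rw [Set.indicator_of_mem hx, norm_mul]
        have h1 : ‖(coneFun 1 x - coneFun (1 - ε) x) / ε‖ ≤ 1 := by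
          rw [norm_div, Real.norm_eq_abs, Real.norm_of_nonneg hε'.le, div_le_one hε']
          have h2 := abs_max_sub_max_le_max 0 (1 - ‖x‖) 0 (1 - ε - ‖x‖)
          rw [sub_self, abs_zero, max_eq_right (a := (0 : ℝ)) (abs_nonneg _)] at h2
          refine h2.trans_eq ?_
          rw [show 1 - ‖x‖ - (1 - ε - ‖x‖) = ε by ring, abs_of_pos hε']
        exact (mul_le_mul (hdb x) h1 (norm_nonneg _) (by positivity)).trans_eq (mul_one _)
      · have hx' : 1 ≤ ‖x‖ := by simpa using hx
        rw [Set.indicator_of_notMem hx, coneFun_of_le hx', coneFun_of_le (by linarith)]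
        simp
    · exact (integrable_indicator_iff measurableSet_ball).2
        (integrableOn_const measure_ball_lt_top.ne)
    · refine .of_forall fun x => tendsto_const_nhds.congr' ?_
      by_cases hx : x ∈ ball (0 : E) 1
      · have hx' : ‖x‖ < 1 := by simpa using hx
        filter_upwards [Ioo_mem_nhdsGT (sub_pos.2 hx')] with ε hε
        rw [Set.indicator_of_mem hx, coneFun_of_ge hx'.le, coneFun_of_ge (by linarith [hε.2]),
          show 1 - ‖x‖ - (1 - ε - ‖x‖) = ε by ring, div_self hε.1.ne', mul_one]
      · have hx' : 1 ≤ ‖x‖ := by simpa using hx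
        filter_upwards [self_mem_nhdsWithin] with ε hε
        have hε' : (0 : ℝ) < ε := hε
        rw [Set.indicator_of_notMem hx, coneFun_of_le hx', coneFun_of_le (by linarith)]
        simp
  -- On the shell, F differs from its radial projection H by at most Cε‖v‖, so after division by ε
  -- the error is of the order of the shell's volume. H depends on the direction only, so its shell
  -- integral is exactly I(1-(1-ε)^m).
  have hA2 : ∀ ε ∈ Set.Ioo (0 : ℝ) 1,
      |A ε - I * ((1 - (1 - ε) ^ m) / ε)|
        ≤ C * ‖v‖ * (μ.real (ball (0 : E) 1) * (1 - (1 - ε) ^ m)) := by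
    intro ε hε
    have hρ : 0 < 1 - ε := by linarith [hε.2]
    have hsub : ball (0 : E) (1 - ε) ⊆ ball 0 1 := ball_subset_ball (by linarith [hε.1])
    have hAε : A ε = (∫ x in ball (0 : E) 1 \ ball 0 (1 - ε), F x ∂μ) / ε := by
      rw [setIntegral_sdiff measurableSet_ball hFi hsub,
        ← integral_lineDeriv_mul_coneFun μ hh v, ← integral_lineDeriv_mul_coneFun μ hh v,
        ← integral_sub (hci _) (hci _), ← integral_div]
      refine integral_congr_ae (.of_forall fun x => ?_)
      simp only
      ring
    have hHε : I * ((1 - (1 - ε) ^ m) / ε)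
        = (∫ x in ball (0 : E) 1 \ ball 0 (1 - ε), H x ∂μ) / ε := by
      rw [setIntegral_sdiff measurableSet_ball hHi hsub, hH,
        setIntegral_ball_comp_direction_scale μ G hρ, ← hm]
      simp only [hI, hH]
      ring
    have hvol : μ.real (ball (0 : E) 1 \ ball 0 (1 - ε))
        = μ.real (ball (0 : E) 1) * (1 - (1 - ε) ^ m) := by
      rw [measureReal_sdiff hsub measurableSet_ball, measureReal_def,
        measureReal_def, Measure.addHaar_ball μ 0 hρ.le, ENNReal.toReal_mul,
        ENNReal.toReal_ofReal (by positivity), ← hm]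
      ring
    have hbound : ‖∫ x in ball (0 : E) 1 \ ball 0 (1 - ε), (F x - H x) ∂μ‖
        ≤ C * ε * ‖v‖ * μ.real (ball (0 : E) 1 \ ball 0 (1 - ε)) := by
      refine norm_setIntegral_le_of_norm_le_const
        ((measure_mono Set.sdiff_subset).trans_lt measure_ball_lt_top) fun x hx => ?_
      have hx1 : ‖x‖ < 1 := by simpa using hx.1
      have hx2 : 1 - ε ≤ ‖x‖ := by simpa using hx.2
      have hx0 : ‖x‖ ≠ 0 := by linarith
      rw [hHeq, hF, ← sub_mul, norm_mul]
      refine mul_le_mul ?_ (abs_inner_div_norm_le x v) (norm_nonneg _)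
        (mul_nonneg C.coe_nonneg hε.1.le)
      refine (hh.norm_sub_le x (‖x‖⁻¹ • x)).trans ?_
      refine mul_le_mul_of_nonneg_left ?_ C.coe_nonneg
      have : x - ‖x‖⁻¹ • x = (1 - ‖x‖⁻¹) • x := by rw [sub_smul, one_smul]
      rw [this, norm_smul, Real.norm_eq_abs, ← abs_norm x, ← abs_mul, sub_mul, abs_norm,
        inv_mul_cancel₀ hx0, abs_le]
      constructor <;> linarith
    rw [integral_sub (hFi.mono_set Set.sdiff_subset) (hHi.mono_set Set.sdiff_subset),
      hvol] at hbound
    rw [hAε, hHε, ← sub_div, abs_div, abs_of_pos hε.1, div_le_iff₀ hε.1]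
    refine hbound.trans_eq ?_
    ring
  have hlim1 : Tendsto (fun ε : ℝ => (1 - ε) ^ m) (𝓝[>] 0) (𝓝 1) := by
    have : Continuous fun ε : ℝ => (1 - ε) ^ m := by fun_prop
    simpa using (this.tendsto 0).mono_left nhdsWithin_le_nhds
  have hlim2 : Tendsto (fun ε : ℝ => (1 - (1 - ε) ^ m) / ε) (𝓝[>] 0) (𝓝 m) := by
    have h1 : HasDerivAt (fun ε : ℝ => (1 - ε) ^ m) (-(m : ℝ)) 0 := by
      simpa using ((hasDerivAt_id' (0 : ℝ)).const_sub 1).fun_pow m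
    have h2 := h1.tendsto_slope_zero_right.neg
    simp only [neg_neg] at h2
    refine h2.congr fun ε => ?_
    simp only [zero_add, sub_zero, one_pow, smul_eq_mul]
    ring
  have hA3 : Tendsto A (𝓝[>] 0) (𝓝 (I * m)) := by
    have h1 : Tendsto (fun ε => C * ‖v‖ * (μ.real (ball (0 : E) 1) * (1 - (1 - ε) ^ m)))
        (𝓝[>] 0) (𝓝 0) := by
      simpa using ((hlim1.const_sub 1).const_mul (μ.real (ball (0 : E) 1))).const_mul (C * ‖v‖)
    have h2 : Tendsto (fun ε => A ε - I * ((1 - (1 - ε) ^ m) / ε)) (𝓝[>] 0) (𝓝 0) := by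
      refine squeeze_zero_norm' ?_ h1
      filter_upwards [Ioo_mem_nhdsGT one_pos] with ε hε using hA2 ε hε
    simpa using h2.add (hlim2.const_mul I)
  -- The factor m, the derivative of 1-(1-ε)^m at 0, cancels the 1/m of the radial integral in I.
  rw [tendsto_nhds_unique hA1 hA3, hI, hH, setIntegral_ball_comp_direction μ G, ← hm, hG]
  field_simp

end Divergence

/-! ### Uniform laws on the sphere and the ball -/

section Uniform

variable {m : ℕ}

theorem unifSphere_eq_smul (m : ℕ) : unifSphere m
    = ((volume : Measure (EuclideanSpace ℝ (Fin m))).toSphere Set.univ)⁻¹ •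
      (volume : Measure (EuclideanSpace ℝ (Fin m))).toSphere.map Subtype.val := by
  rw [unifSphere, ProbabilityTheory.cond, Measure.restrict_univ, Measure.map_smul]

theorem isProbabilityMeasure_unifSphere (hm : 0 < m) : IsProbabilityMeasure (unifSphere m) := by
  have : NeZero m := ⟨hm.ne'⟩
  have := ProbabilityTheory.cond_isProbabilityMeasure
    (μ := (volume : Measure (EuclideanSpace ℝ (Fin m))).toSphere) (s := Set.univ)
    (by rw [Ne, Measure.measure_univ_eq_zero]; exact Measure.toSphere_ne_zero volume)
  rw [unifSphere]
  exact Measure.isProbabilityMeasure_map measurable_subtype_coe.aemeasurable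

instance isProbabilityMeasure_unifBall (m : ℕ) : IsProbabilityMeasure (unifBall m) :=
  ProbabilityTheory.cond_isProbabilityMeasure_of_finite (measure_closedBall_pos _ _ one_pos).ne'
    measure_closedBall_lt_top.ne

theorem ae_unifSphere (m : ℕ) : ∀ᵐ u ∂unifSphere m, ‖u‖ = 1 := by
  rw [unifSphere, ae_map_iff measurable_subtype_coe.aemeasurable
    (measurableSet_eq_fun measurable_norm measurable_const)]
  exact .of_forall fun u => by simp

/-- The bounding sphere is null, so the closed ball may be replaced by the open one, where
derivatives are taken at interior points. In dimension 0 the two balls coincide. -/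
theorem unifBall_eq_smul (m : ℕ) : unifBall m
    = ((volume : Measure (EuclideanSpace ℝ (Fin m))) (ball 0 1))⁻¹ • volume.restrict (ball 0 1) := by
  rcases Nat.eq_zero_or_pos m with rfl | hm
  · have : closedBall (0 : EuclideanSpace ℝ (Fin 0)) 1 = ball 0 1 := by
      ext x; simp [Subsingleton.elim x 0]
    rw [unifBall, ProbabilityTheory.cond, this]
  · have : NeZero m := ⟨hm.ne'⟩
    have h : (ball (0 : EuclideanSpace ℝ (Fin m)) 1) =ᵐ[volume] closedBall 0 1 := by
      refine (ae_eq_of_subset_of_measure_ge ball_subset_closedBall ?_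
        measurableSet_ball.nullMeasurableSet measure_closedBall_lt_top.ne)
      rw [Measure.addHaar_closedBall_eq_addHaar_ball]
    rw [unifBall, ProbabilityTheory.cond, Measure.addHaar_closedBall_eq_addHaar_ball,
      Measure.restrict_congr_set h]

theorem ae_unifBall (m : ℕ) : ∀ᵐ u ∂unifBall m, ‖u‖ < 1 := by
  rw [unifBall_eq_smul]
  refine Measure.ae_smul_measure ?_ _
  filter_upwards [ae_restrict_mem measurableSet_ball] with x hx using by simpa using hx

/-- The divergence theorem after normalization: m is the ratio of the area of the sphere to the
volume of the ball. -/
theorem integral_lineDeriv_unifBall (hm : 0 < m) {h : EuclideanSpace ℝ (Fin m) → ℝ} {C : NNReal}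
    (hh : LipschitzWith C h) (v : EuclideanSpace ℝ (Fin m)) :
    ∫ x, lineDeriv ℝ h x v ∂unifBall m = m * ∫ u, h u * inner ℝ u v ∂unifSphere m := by
  have : NeZero m := ⟨hm.ne'⟩
  have hc : Continuous fun u : EuclideanSpace ℝ (Fin m) => h u * inner ℝ u v :=
    hh.continuous.mul (by fun_prop)
  rw [unifBall_eq_smul, unifSphere_eq_smul, integral_smul_measure, integral_smul_measure,
    setIntegral_ball_lineDeriv volume hh v,
    integral_map measurable_subtype_coe.aemeasurable hc.aestronglyMeasurable,
    Measure.toSphere_apply_univ, ENNReal.mul_inv (.inl (by simpa using hm.ne')) (.inl (by simp)), ENNReal.toReal_mul,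
    finrank_euclideanSpace_fin, smul_eq_mul, smul_eq_mul]
  have : (m : ℝ) ≠ 0 := by exact_mod_cast hm.ne'
  simp only [ENNReal.toReal_inv, ENNReal.toReal_natCast]
  field_simp

/-- The gradient averaged over a ball is the average over the sphere of the single-point
estimates. -/
theorem integral_inner_gradient_unifBall (hm : 0 < m) {f : EuclideanSpace ℝ (Fin m) → ℝ}
    {G : EuclideanSpace ℝ (Fin m) → EuclideanSpace ℝ (Fin m)} {s : Set (EuclideanSpace ℝ (Fin m))}
    {y : EuclideanSpace ℝ (Fin m)} {δ C : ℝ} (hδ : 0 < δ)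
    (hs : ∀ w : EuclideanSpace ℝ (Fin m), ‖w‖ ≤ 1 → y + δ • w ∈ s)
    (hG : ∀ z ∈ s, HasGradientWithinAt f (G z) s z) (hC : ∀ z ∈ s, ‖G z‖ ≤ C)
    (v : EuclideanSpace ℝ (Fin m)) :
    ∫ w, inner ℝ (G (y + δ • w)) v ∂unifBall m
      = m / δ * ∫ u, f (y + δ • u) * inner ℝ u v ∂unifSphere m := by
  set k : EuclideanSpace ℝ (Fin m) → ℝ := fun w => f (y + δ • w) with hk
  have haff : ∀ w, HasFDerivAt (fun w : EuclideanSpace ℝ (Fin m) => y + δ • w)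
      (δ • ContinuousLinearMap.id ℝ (EuclideanSpace ℝ (Fin m))) w := fun w =>
    ((hasFDerivAt_id w).const_smul δ).const_add y
  have hC0 : 0 ≤ C := (norm_nonneg _).trans (hC (y + δ • 0) (hs 0 (by simp)))
  have hd : ∀ w ∈ closedBall (0 : EuclideanSpace ℝ (Fin m)) 1, HasFDerivWithinAt k
      (((InnerProductSpace.toDual ℝ _) (G (y + δ • w))).comp
        (δ • ContinuousLinearMap.id ℝ (EuclideanSpace ℝ (Fin m)))) (closedBall 0 1) w := by
    intro w hw
    exact (hG _ (hs w (by simpa using hw))).hasFDerivWithinAt.comp w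
      (haff w).hasFDerivWithinAt fun z hz => hs z (by simpa using hz)
  have hlip : LipschitzOnWith (C * δ).toNNReal k (closedBall 0 1) := by
    refine (convex_closedBall _ _).lipschitzOnWith_of_nnnorm_hasFDerivWithin_le hd fun w hw => ?_
    rw [← NNReal.coe_le_coe, coe_nnnorm, Real.coe_toNNReal _ (by positivity)]
    refine (ContinuousLinearMap.opNorm_comp_le _ _).trans ?_
    refine mul_le_mul ?_ ?_ (norm_nonneg _) hC0
    · simpa using hC _ (hs w (by simpa using hw))
    · rw [norm_smul, Real.norm_of_nonneg hδ.le]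
      exact mul_le_of_le_one_right hδ.le ContinuousLinearMap.norm_id_le
  -- The divergence theorem asks for a globally Lipschitz function, while k is controlled only on
  -- the closed ball. An extension has the same values on the sphere and the same line derivatives
  -- in the open ball.
  obtain ⟨h, hh, heq⟩ := hlip.extend_real
  have h1 := integral_lineDeriv_unifBall hm hh v
  have h2 : ∫ x, lineDeriv ℝ h x v ∂unifBall m
      = δ * ∫ w, inner ℝ (G (y + δ • w)) v ∂unifBall m := by
    rw [← integral_const_mul]
    refine integral_congr_ae ?_
    filter_upwards [ae_unifBall m] with w hw
    have hnhds : closedBall (0 : EuclideanSpace ℝ (Fin m)) 1 ∈ nhds w :=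
      Filter.mem_of_superset (isOpen_ball.mem_nhds (by simpa using hw)) ball_subset_closedBall
    have h3 : h =ᶠ[nhds w] k := Filter.mem_of_superset hnhds fun z hz => (heq hz).symm
    rw [h3.lineDeriv_eq,
      ((hd w (by simpa using hw.le)).hasFDerivAt hnhds |>.hasLineDerivAt v).lineDeriv]
    simp
  have h4 : ∫ u, h u * inner ℝ u v ∂unifSphere m
      = ∫ u, f (y + δ • u) * inner ℝ u v ∂unifSphere m := by
    refine integral_congr_ae ?_
    filter_upwards [ae_unifSphere m] with u hu
    rw [← heq (by simp [hu])]
  rw [h2, h4] at h1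
  field_simp
  linarith

end Uniform

/-! ### Metric projections and variational inequalities -/

section VariationalInequality

variable {H : Type*} [NormedAddCommGroup H] [InnerProductSpace ℝ H] {K : Set H}

/-- `x` solves the variational inequality of the map `G` over `K`. -/
def IsVISol (K : Set H) (G : H → H) (x : H) : Prop :=
  x ∈ K ∧ ∀ y ∈ K, 0 ≤ inner ℝ (G x) (y - x)

theorem IsVISol.unique {G : H → H} {m : ℝ} (hm : 0 < m)
    (hmono : ∀ x ∈ K, ∀ y ∈ K, m * ‖x - y‖ ^ 2 ≤ inner ℝ (G x - G y) (x - y)) {x y : H}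
    (hx : IsVISol K G x) (hy : IsVISol K G y) : x = y := by
  have h1 := hx.2 y hy.1
  have h2 := hy.2 x hx.1
  have h3 := hmono x hx.1 y hy.1
  rw [← neg_sub x y, inner_neg_right] at h1
  rw [inner_sub_left] at h3
  have h4 : ‖x - y‖ ^ 2 ≤ 0 := by nlinarith
  have h5 : ‖x - y‖ = 0 := by nlinarith [sq_nonneg ‖x - y‖]
  exact sub_eq_zero.1 (norm_eq_zero.1 h5)

variable [CompleteSpace H]

theorem metricProj_spec (hne : K.Nonempty) (hcl : IsClosed K) (hcv : Convex ℝ K) (u : H) :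
    metricProj K u ∈ K ∧ ∀ y ∈ K, ‖u - metricProj K u‖ ≤ ‖u - y‖ := by
  obtain ⟨p, hp, heq⟩ := exists_norm_eq_iInf_of_complete_convex hne hcl.isComplete hcv u
  have h : ∃ p, p ∈ K ∧ ∀ y ∈ K, ‖u - p‖ ≤ ‖u - y‖ := by
    refine ⟨p, hp, fun y hy => ?_⟩
    rw [heq]
    exact ciInf_le ⟨0, Set.forall_mem_range.2 fun _ => norm_nonneg _⟩ (⟨y, hy⟩ : K)
  exact Classical.epsilon_spec h

theorem inner_metricProj_le_zero (hne : K.Nonempty) (hcl : IsClosed K) (hcv : Convex ℝ K) (u : H)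
    {y : H} (hy : y ∈ K) : inner ℝ (u - metricProj K u) (y - metricProj K u) ≤ 0 := by
  obtain ⟨hp, hmin⟩ := metricProj_spec hne hcl hcv u
  refine (norm_eq_iInf_iff_real_inner_le_zero hcv hp).1 ?_ y hy
  have : Nonempty K := hne.to_subtype
  refine le_antisymm (le_ciInf fun w => hmin w w.2) ?_
  exact ciInf_le ⟨0, Set.forall_mem_range.2 fun _ => norm_nonneg _⟩ (⟨_, hp⟩ : K)

/-- Adding the two obtuse-angle inequalities gives ‖p-q‖² ≤ ⟨u-w, p-q⟩; Cauchy–Schwarz concludes. -/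
theorem norm_metricProj_sub_metricProj_le (hne : K.Nonempty) (hcl : IsClosed K) (hcv : Convex ℝ K)
    (u w : H) : ‖metricProj K u - metricProj K w‖ ≤ ‖u - w‖ := by
  have h1 := inner_metricProj_le_zero hne hcl hcv u (metricProj_spec hne hcl hcv w).1
  have h2 := inner_metricProj_le_zero hne hcl hcv w (metricProj_spec hne hcl hcv u).1
  set p := metricProj K u
  set q := metricProj K w
  have h3 : ‖p - q‖ ^ 2 ≤ inner ℝ (u - w) (p - q) := by
    rw [← real_inner_self_eq_norm_sq]
    have e : inner ℝ (u - w) (p - q) - inner ℝ (p - q) (p - q)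
        = -inner ℝ (u - p) (q - p) - inner ℝ (w - q) (p - q) := by
      rw [← neg_sub p q, inner_neg_right, neg_neg, ← inner_sub_left, ← inner_sub_left]
      congr 1
      abel
    linarith
  have h4 := h3.trans (real_inner_le_norm _ _)
  rcases (norm_nonneg (p - q)).eq_or_lt with h0 | h0
  · rw [← h0]; positivity
  · nlinarith

theorem metricProj_of_mem (hne : K.Nonempty) (hcl : IsClosed K) (hcv : Convex ℝ K) {x : H}
    (hx : x ∈ K) : metricProj K x = x := by
  have := (metricProj_spec hne hcl hcv x).2 x hx
  rw [sub_self, norm_zero, norm_le_zero_iff, sub_eq_zero] at this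
  exact this.symm

theorem norm_metricProj_sub_le (hne : K.Nonempty) (hcl : IsClosed K) (hcv : Convex ℝ K) (u : H)
    {x : H} (hx : x ∈ K) : ‖metricProj K u - x‖ ≤ ‖u - x‖ := by
  have := norm_metricProj_sub_metricProj_le hne hcl hcv u x
  rwa [metricProj_of_mem hne hcl hcv hx] at this

theorem continuous_metricProj (hne : K.Nonempty) (hcl : IsClosed K) (hcv : Convex ℝ K) :
    Continuous (metricProj K : H → H) :=
  (LipschitzWith.of_dist_le_mul (K := 1) fun u w => by
    simpa [dist_eq_norm] using norm_metricProj_sub_metricProj_le hne hcl hcv u w).continuous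

/-- A fixed point of x ↦ proj(x - γ G x) is a solution. The squared contraction factor 1 - 2γm +
γ²k² is least at γ = m/k², where it equals 1 - m²/k². -/
theorem exists_isVISol {G : H → H} {m l : ℝ} (hm : 0 < m) (hne : K.Nonempty) (hcl : IsClosed K)
    (hcv : Convex ℝ K)
    (hmono : ∀ x ∈ K, ∀ y ∈ K, m * ‖x - y‖ ^ 2 ≤ inner ℝ (G x - G y) (x - y))
    (hlip : ∀ x ∈ K, ∀ y ∈ K, ‖G x - G y‖ ≤ l * ‖x - y‖) : ∃ x, IsVISol K G x := by
  -- Enlarging the Lipschitz constant to at least m keeps k positive and 1 - m²/k² nonnegative.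
  set k : ℝ := max l m with hk
  have hkpos : 0 < k := hm.trans_le (le_max_right _ _)
  set γ : ℝ := m / k ^ 2 with hγ
  have hγpos : 0 < γ := by positivity
  set T : H → H := fun x => metricProj K (x - γ • G x) with hT
  have hmaps : Set.MapsTo T K K := fun x _ => (metricProj_spec hne hcl hcv _).1
  set q : ℝ := Real.sqrt (1 - m ^ 2 / k ^ 2) with hq
  have hmk : m ^ 2 / k ^ 2 ≤ 1 := by
    rw [div_le_one (by positivity)]
    exact pow_le_pow_left₀ hm.le (le_max_right _ _) 2
  have hq0 : 0 ≤ q := Real.sqrt_nonneg _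
  have hqsq : q ^ 2 = 1 - m ^ 2 / k ^ 2 := Real.sq_sqrt (by linarith)
  have hq1 : q < 1 := by
    have : 0 < m ^ 2 / k ^ 2 := by positivity
    nlinarith
  have hcontr : ∀ x ∈ K, ∀ y ∈ K, ‖T x - T y‖ ≤ q * ‖x - y‖ := by
    intro x hx y hy
    refine (norm_metricProj_sub_metricProj_le hne hcl hcv _ _).trans ?_
    refine (sq_le_sq₀ (norm_nonneg _) (by positivity)).1 ?_
    have e : x - γ • G x - (y - γ • G y) = (x - y) - γ • (G x - G y) := by
      rw [smul_sub]; abel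
    rw [e, norm_sub_sq_real, mul_pow, hqsq, real_inner_smul_right, norm_smul,
      Real.norm_of_nonneg hγpos.le, real_inner_comm]
    have h1 := hmono x hx y hy
    have h2 : ‖G x - G y‖ ≤ k * ‖x - y‖ :=
      (hlip x hx y hy).trans (mul_le_mul_of_nonneg_right (le_max_left _ _) (norm_nonneg _))
    have h3 : (γ * ‖G x - G y‖) ^ 2 ≤ (γ * (k * ‖x - y‖)) ^ 2 :=
      pow_le_pow_left₀ (by positivity) (mul_le_mul_of_nonneg_left h2 hγpos.le) 2
    have h4 : (γ * (k * ‖x - y‖)) ^ 2 = m ^ 2 / k ^ 2 * ‖x - y‖ ^ 2 := by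
      rw [hγ]; field_simp
    have h5 : γ * (m * ‖x - y‖ ^ 2) = m ^ 2 / k ^ 2 * ‖x - y‖ ^ 2 := by
      rw [hγ]; field_simp
    have h6 := mul_le_mul_of_nonneg_left h1 hγpos.le
    nlinarith
  have hC : ContractingWith ⟨q, hq0⟩ (hmaps.restrict T K K) := by
    refine ⟨by exact_mod_cast hq1, LipschitzWith.of_dist_le_mul fun x y => ?_⟩
    rw [Subtype.dist_eq, Subtype.dist_eq, dist_eq_norm, dist_eq_norm]
    exact hcontr x x.2 y y.2
  obtain ⟨x0, hx0⟩ := hne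
  obtain ⟨x, hxK, hfix, -⟩ := hC.exists_fixedPoint' hcl.isComplete hmaps hx0 (edist_ne_top _ _)
  refine ⟨x, hxK, fun y hy => ?_⟩
  have h1 := inner_metricProj_le_zero ⟨x0, hx0⟩ hcl hcv (x - γ • G x) hy
  have h2 : metricProj K (x - γ • G x) = x := hfix
  rw [h2, sub_sub_cancel_left, inner_neg_left, real_inner_smul_left] at h1
  nlinarith

end VariationalInequality

/-! ### Quadratic lower bounds from a strongly monotone gradient -/

section FirstOrder

variable {E : Type*} [NormedAddCommGroup E] [InnerProductSpace ℝ E] [CompleteSpace E]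

/-- A function with strongly monotone gradient lies above its tangents by a quadratic. -/
theorem tangent_add_sq_le {s : Set E} (hs : Convex ℝ s) {f : E → ℝ} {G : E → E} {a : ℝ}
    (hG : ∀ z ∈ s, HasGradientWithinAt f (G z) s z)
    (hmono : ∀ z ∈ s, ∀ y ∈ s, a * ‖z - y‖ ^ 2 ≤ inner ℝ (G z - G y) (z - y))
    {y z : E} (hy : y ∈ s) (hz : z ∈ s) :
    f y + inner ℝ (G y) (z - y) + a / 2 * ‖z - y‖ ^ 2 ≤ f z := by
  set p : ℝ → E := fun t => y + t • (z - y) with hp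
  have hps : ∀ t ∈ Set.Icc (0 : ℝ) 1, p t ∈ s := fun t ht =>
    hs.add_smul_sub_mem hy hz ht
  have hpd : ∀ t, HasDerivAt p (z - y) t := fun t => by
    simpa [hp] using ((hasDerivAt_id t).smul_const (z - y)).const_add y
  -- φ is f along the segment minus the tangent and the quadratic. Strong monotonicity makes its
  -- derivative nonnegative, and φ 0 ≤ φ 1 is the claim.
  set φ : ℝ → ℝ := fun t => f (p t) - t * inner ℝ (G y) (z - y) - a / 2 * ‖z - y‖ ^ 2 * t ^ 2
    with hφ
  have hd : ∀ t ∈ Set.Icc (0 : ℝ) 1, HasDerivWithinAt φ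
      (inner ℝ (G (p t)) (z - y) - inner ℝ (G y) (z - y) - a * ‖z - y‖ ^ 2 * t)
      (Set.Icc 0 1) t := by
    intro t ht
    have h1 := (hG (p t) (hps t ht)).hasFDerivWithinAt.comp_hasDerivWithinAt t
      (hpd t).hasDerivWithinAt hps
    rw [InnerProductSpace.toDual_apply_apply] at h1
    have h2 := ((hasDerivAt_id' t).mul_const (inner ℝ (G y) (z - y))).hasDerivWithinAt
      (s := Set.Icc 0 1)
    have h3 := (((hasDerivAt_id' t).fun_pow 2).const_mul
      (a / 2 * ‖z - y‖ ^ 2)).hasDerivWithinAt (s := Set.Icc 0 1)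
    refine ((h1.sub h2).sub h3).congr_deriv ?_
    push_cast
    ring
  have hmonoφ : MonotoneOn φ (Set.Icc 0 1) := by
    refine monotoneOn_of_hasDerivWithinAt_nonneg (convex_Icc _ _)
      (fun t ht => (hd t ht).continuousWithinAt)
      (fun t ht => (hd t (interior_subset ht)).mono interior_subset) fun t ht => ?_
    rw [interior_Icc] at ht
    have h1 := hmono (p t) (hps t ⟨ht.1.le, ht.2.le⟩) y hy
    have h2 : p t - y = t • (z - y) := by simp [hp]
    rw [h2, norm_smul, real_inner_smul_right, inner_sub_left, Real.norm_of_nonneg ht.1.le] at h1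
    have h3 : t * (a * ‖z - y‖ ^ 2 * t) ≤ t * (inner ℝ (G (p t)) (z - y) - inner ℝ (G y) (z - y)) := by
      linarith
    have h4 := le_of_mul_le_mul_left h3 ht.1
    linarith
  have h := hmonoφ (Set.left_mem_Icc.2 zero_le_one) (Set.right_mem_Icc.2 zero_le_one) zero_le_one
  simp only [hφ, hp, zero_smul, add_zero, one_smul, add_sub_cancel] at h
  linarith

end FirstOrder

/-! ### Profiles, deviations, and Nash equilibria as variational solutions -/

section Profiles

variable {n : ℕ} {d : Fin n → ℕ}

@[simp] theorem deviate_same (x : Profile d) (i : Fin n) (y : EuclideanSpace ℝ (Fin (d i))) :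
    deviate x i y i = y := by simp [deviate]

theorem deviate_of_ne (x : Profile d) {i j : Fin n} (h : j ≠ i)
    (y : EuclideanSpace ℝ (Fin (d i))) : deviate x i y j = x j := by simp [deviate, h]

@[simp] theorem deviate_self (x : Profile d) (i : Fin n) : deviate x i (x i) = x := by
  ext1 j
  by_cases h : j = i
  · subst h; simp
  · rw [deviate_of_ne x h]

@[simp] theorem deviate_deviate (x : Profile d) (i : Fin n) (y z : EuclideanSpace ℝ (Fin (d i))) :
    deviate (deviate x i y) i z = deviate x i z := by
  ext1 j
  by_cases h : j = i
  · subst h; simp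
  · rw [deviate_of_ne _ h, deviate_of_ne _ h, deviate_of_ne _ h]

theorem inner_deviate_sub_deviate (A x : Profile d) (i : Fin n)
    (y z : EuclideanSpace ℝ (Fin (d i))) :
    inner ℝ A (deviate x i y - deviate x i z) = inner ℝ (A i) (y - z) := by
  rw [PiLp.inner_apply, Finset.sum_eq_single i]
  · simp
  · intro j _ hj
    simp [deviate_of_ne _ hj]
  · simp

theorem inner_deviate_sub (A x : Profile d) (i : Fin n) (y : EuclideanSpace ℝ (Fin (d i))) :
    inner ℝ A (deviate x i y - x) = inner ℝ (A i) (y - x i) := by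
  simpa using inner_deviate_sub_deviate A x i y (x i)

theorem norm_deviate_sub_deviate (x : Profile d) (i : Fin n)
    (y z : EuclideanSpace ℝ (Fin (d i))) : ‖deviate x i y - deviate x i z‖ = ‖y - z‖ := by
  have h := inner_deviate_sub_deviate (deviate x i y - deviate x i z) x i y z
  rw [PiLp.sub_apply, deviate_same, deviate_same, real_inner_self_eq_norm_sq,
    real_inner_self_eq_norm_sq] at h
  exact (sq_eq_sq₀ (norm_nonneg _) (norm_nonneg _)).1 h

theorem norm_deviate_sub (x : Profile d) (i : Fin n) (y : EuclideanSpace ℝ (Fin (d i))) :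
    ‖deviate x i y - x‖ = ‖y - x i‖ := by
  simpa using norm_deviate_sub_deviate x i y (x i)

theorem Profile.norm_sq (x : Profile d) : ‖x‖ ^ 2 = ∑ i, ‖x i‖ ^ 2 := PiLp.norm_sq_eq_of_L2 _ x

theorem Profile.norm_apply_le (x : Profile d) (i : Fin n) : ‖x i‖ ≤ ‖x‖ := PiLp.norm_apply_le x i

theorem Profile.norm_le_sqrt_mul {x : Profile d} {c : ℝ} (hc : 0 ≤ c) (h : ∀ i, ‖x i‖ ≤ c) :
    ‖x‖ ≤ Real.sqrt n * c := by
  refine (sq_le_sq₀ (norm_nonneg _) (by positivity)).1 ?_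
  rw [Profile.norm_sq, mul_pow, Real.sq_sqrt (Nat.cast_nonneg n)]
  calc ∑ i, ‖x i‖ ^ 2 ≤ ∑ _i : Fin n, c ^ 2 :=
        Finset.sum_le_sum fun i _ => pow_le_pow_left₀ (norm_nonneg _) (h i) 2
    _ = n * c ^ 2 := by simp

variable {K : ∀ i : Fin n, Set (EuclideanSpace ℝ (Fin (d i)))}

theorem deviate_mem {x : Profile d} (hx : x ∈ prodSet K) {i : Fin n}
    {y : EuclideanSpace ℝ (Fin (d i))} (hy : y ∈ K i) : deviate x i y ∈ prodSet K := by
  intro j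
  by_cases h : j = i
  · subst h; simpa using hy
  · rw [deviate_of_ne x h]; exact hx j

theorem convex_prodSet (hK : ∀ i, Convex ℝ (K i)) : Convex ℝ (prodSet K) :=
  fun _ hx _ hy _ _ ha hb hab i => hK i (hx i) (hy i) ha hb hab

theorem isClosed_prodSet (hK : ∀ i, IsClosed (K i)) : IsClosed (prodSet K) := by
  have : prodSet K = ⋂ i, (fun x : Profile d => x i) ⁻¹' K i := by
    ext x; simp [prodSet]
  rw [this]
  exact isClosed_iInter fun i => (hK i).preimage (by fun_prop)

/-- Nash equilibria are the solutions of the variational inequality of a pseudo-gradient. -/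
theorem isNash_iff_isVISol (hK : ∀ i, Convex ℝ (K i)) {h : Fin n → Profile d → ℝ}
    {G : Profile d → Profile d} {l : ℝ}
    (hlip : ∀ x ∈ prodSet K, ∀ y ∈ prodSet K, ‖G x - G y‖ ≤ l * ‖x - y‖)
    (htan : ∀ i, ∀ x ∈ prodSet K, ∀ z ∈ K i,
      h i x + inner ℝ (G x i) (z - x i) ≤ h i (deviate x i z)) {x : Profile d} :
    IsNash K h x ↔ IsVISol (prodSet K) G x := by
  constructor
  · rintro ⟨hx, hmin⟩
    refine ⟨hx, fun y hy => ?_⟩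
    rw [PiLp.inner_apply]
    refine Finset.sum_nonneg fun i _ => ?_
    rw [PiLp.sub_apply]
    set z := y i with hz
    set B := ‖z - x i‖ with hB
    -- The tangent inequality is taken at the deviated point and looks back at x. With minimality it
    -- gives ⟨G(deviate x i p)_i, z - x_i⟩ ≥ 0, and the Lipschitz bound transfers this to x with an
    -- error O(t). The costs are never differentiated, so the argument applies to the smoothed costs
    -- too.
    have key : ∀ t ∈ Set.Ioc (0 : ℝ) 1, -(l * (t * B) * B) ≤ inner ℝ (G x i) (z - x i) := by
      intro t ht
      set p := x i + t • (z - x i) with hp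
      have hpK : p ∈ K i := (hK i).add_smul_sub_mem (hx i) (hy i) ⟨ht.1.le, ht.2⟩
      have hq : deviate x i p ∈ prodSet K := deviate_mem hx hpK
      have h1 := htan i _ hq (x i) (hx i)
      rw [deviate_deviate, deviate_self, deviate_same, hp, sub_add_cancel_left, inner_neg_right,
        real_inner_smul_right, ← hp] at h1
      have h2 := hmin i p hpK
      have h3 : 0 ≤ inner ℝ (G (deviate x i p) i) (z - x i) := by
        have : 0 ≤ t * inner ℝ (G (deviate x i p) i) (z - x i) := by linarith
        exact nonneg_of_mul_nonneg_right this ht.1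
      have h4 : ‖G (deviate x i p) i - G x i‖ ≤ l * (t * B) := by
        refine (Profile.norm_apply_le (G (deviate x i p) - G x) i).trans ?_
        refine (hlip _ hq _ hx).trans_eq ?_
        rw [norm_deviate_sub, hp, add_sub_cancel_left, norm_smul, Real.norm_of_nonneg ht.1.le]
      have h5 := real_inner_le_norm (G (deviate x i p) i - G x i) (z - x i)
      rw [inner_sub_left] at h5
      have h6 := mul_le_mul_of_nonneg_right h4 (norm_nonneg (z - x i))
      linarith
    have hlim : Filter.Tendsto (fun t : ℝ => -(l * (t * B) * B)) (nhdsWithin 0 (Set.Ioi 0))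
        (nhds 0) := by
      have : Continuous fun t : ℝ => -(l * (t * B) * B) := by fun_prop
      simpa using (this.tendsto 0).mono_left nhdsWithin_le_nhds
    refine le_of_tendsto hlim ?_
    filter_upwards [Ioc_mem_nhdsGT one_pos] with t ht using key t ht
  · rintro ⟨hx, hvi⟩
    refine ⟨hx, fun i y hy => ?_⟩
    have h1 := hvi _ (deviate_mem hx hy)
    rw [inner_deviate_sub] at h1
    linarith [htan i x hx y hy]

end Profiles

/-! ### The equilibrium of the original game -/

namespace Standing

variable {n : ℕ} {d : Fin n → ℕ} {X : ∀ i : Fin n, Set (EuclideanSpace ℝ (Fin (d i)))}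
  {f : Fin n → Profile d → ℝ} {α β L r R : ℝ}

theorem zero_mem (hg : Standing X f α β L r R) (i : Fin n) : (0 : EuclideanSpace ℝ (Fin (d i))) ∈ X i :=
  hg.ball_subset (mem_closedBall_self hg.r_pos.le) i

theorem hasGradientWithinAt (hg : Standing X f α β L r R) {i : Fin n} {x : Profile d}
    (hx : x ∈ prodSet X) {y : EuclideanSpace ℝ (Fin (d i))} (hy : y ∈ X i) :
    HasGradientWithinAt (fun z => f i (deviate x i z)) (partialGrad X f i (deviate x i y)) (X i) y := by
  have h := (hg.differentiable i x hx y hy).hasGradientWithinAt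
  simpa [partialGrad] using h

/-- `f_i` is `α`-strongly convex in `x_i`. -/
theorem tangent_add_sq_le (hg : Standing X f α β L r R) {i : Fin n} {x : Profile d}
    (hx : x ∈ prodSet X) {z : EuclideanSpace ℝ (Fin (d i))} (hz : z ∈ X i) :
    f i x + inner ℝ (partialGrad X f i x) (z - x i) + α / 2 * ‖z - x i‖ ^ 2
      ≤ f i (deviate x i z) := by
  have h := DFGame.tangent_add_sq_le (hg.convex i) (a := α)
    (G := fun y => partialGrad X f i (deviate x i y))
    (fun y hy => hg.hasGradientWithinAt hx hy) ?_ (hx i) hz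
  · simpa using h
  · intro z hz y hy
    have h1 := hg.strongly_monotone _ (deviate_mem hx hz) _ (deviate_mem hx hy)
    rw [inner_deviate_sub_deviate, norm_deviate_sub_deviate] at h1
    simpa [gameGrad] using h1

theorem norm_gameGrad_sub_le (hg : Standing X f α β L r R) {x y : Profile d} (hx : x ∈ prodSet X)
    (hy : y ∈ prodSet X) :
    ‖gameGrad X f x - gameGrad X f y‖ ≤ β * Real.sqrt n * ‖x - y‖ := by
  have h := Profile.norm_le_sqrt_mul (x := gameGrad X f x - gameGrad X f y)
    (mul_nonneg hg.beta_nonneg (norm_nonneg (x - y))) fun i => by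
      simpa [gameGrad] using hg.grad_lipschitz i x hx y hy
  linarith

theorem nonempty_prodSet (hg : Standing X f α β L r R) : (prodSet X).Nonempty :=
  ⟨0, fun i => hg.zero_mem i⟩

theorem isNash_iff (hg : Standing X f α β L r R) {x : Profile d} :
    IsNash X f x ↔ IsVISol (prodSet X) (gameGrad X f) x :=
  isNash_iff_isVISol hg.convex (fun _ hx _ hy => hg.norm_gameGrad_sub_le hx hy)
    fun i x hx z hz => by
      have h1 := hg.tangent_add_sq_le hx hz
      have h2 : 0 ≤ α / 2 * ‖z - x i‖ ^ 2 := by have := hg.alpha_pos; positivity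
      have h3 : gameGrad X f x i = partialGrad X f i x := rfl
      rw [h3]
      linarith

theorem existsUnique_isNash (hg : Standing X f α β L r R) : ∃! x, IsNash X f x := by
  obtain ⟨x, hx⟩ := exists_isVISol hg.alpha_pos hg.nonempty_prodSet
    (isClosed_prodSet hg.isClosed) (convex_prodSet hg.convex) hg.strongly_monotone
    (fun _ hx _ hy => hg.norm_gameGrad_sub_le hx hy)
  exact ⟨x, hg.isNash_iff.2 hx, fun y hy =>
    IsVISol.unique hg.alpha_pos hg.strongly_monotone (hg.isNash_iff.1 hy) hx⟩

/-- The mixed difference of a partial gradient under a common translation. -/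
theorem norm_partialGrad_mixed_sub_le (hg : Standing X f α β L r R) (i : Fin n) {S : Set (Profile d)}
    (hS : Convex ℝ S) (hSX : S ⊆ prodSet X) {w : Profile d} (hw : ∀ x ∈ S, x + w ∈ prodSet X)
    {x y : Profile d} (hx : x ∈ S) (hy : y ∈ S) :
    ‖(partialGrad X f i (x + w) - partialGrad X f i (y + w))
      - (partialGrad X f i x - partialGrad X f i y)‖ ≤ L * ‖w‖ * ‖x - y‖ := by
  set g := partialGrad X f i
  -- The mean value inequality is applied to z ↦ g(z + w) - g(z), whose derivative is a difference
  -- of Jacobians at distance ‖w‖, hence at most L‖w‖.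
  have hd : ∀ z ∈ S, HasFDerivWithinAt (fun z => g (z + w) - g z)
      (fderivWithin ℝ g (prodSet X) (z + w) - fderivWithin ℝ g (prodSet X) z) S z := by
    intro z hz
    have h1 := (hg.grad_differentiable i (z + w) (hw z hz)).hasFDerivWithinAt
    have h2 := h1.comp (x := z) ((hasFDerivAt_id z).add_const w).hasFDerivWithinAt (s := S) hw
    exact h2.sub ((hg.grad_differentiable i z (hSX hz)).hasFDerivWithinAt.mono hSX)
  have h := hS.norm_image_sub_le_of_norm_hasFDerivWithin_le hd (C := L * ‖w‖) (fun z hz => by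
    simpa using hg.jacobian_lipschitz i _ (hw z hz) z (hSX hz)) hy hx
  rwa [sub_sub_sub_comm] at h

end Standing

/-! ### Extension by zero, and resampling one coordinate of a product measure -/

theorem measurable_indicator_of_restrict {A B : Type*} [MeasurableSpace A] [MeasurableSpace B]
    [Zero B] {s : Set A} (hs : MeasurableSet s) {φ : A → B}
    (hφ : Measurable fun x : s => φ x) : Measurable (s.indicator φ) := by
  classical
  have : s.indicator φ = fun x => if h : x ∈ s then φ (⟨x, h⟩ : s) else 0 := by
    ext x
    by_cases h : x ∈ s <;> simp [h]
  rw [this]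
  exact Measurable.dite hφ measurable_const hs

/-- Resampling one coordinate of a product measure. -/
theorem measurePreserving_update {ι : Type*} [Fintype ι] [DecidableEq ι] {A : ι → Type*}
    [∀ i, MeasurableSpace (A i)] (μ : ∀ i, Measure (A i)) [∀ i, IsProbabilityMeasure (μ i)] (i : ι)
    (ν : Measure (A i)) [IsProbabilityMeasure ν] :
    MeasurePreserving (fun p : (∀ j, A j) × A i => Function.update p.1 i p.2)
      ((Measure.pi μ).prod ν) (Measure.pi (Function.update μ i ν)) := by
  have hm : Measurable fun p : (∀ j, A j) × A i => Function.update p.1 i p.2 := by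
    refine measurable_pi_iff.2 fun j => ?_
    by_cases h : j = i
    · subst h; simpa using measurable_snd
    · simpa [h, Function.comp_def] using (measurable_pi_apply (X := A) j).comp measurable_fst
  have hprob : ∀ j, IsProbabilityMeasure (Function.update μ i ν j) := by
    intro j
    by_cases h : j = i
    · subst h; simpa
    · simpa [h] using inferInstanceAs (IsProbabilityMeasure (μ j))
  refine ⟨hm, (Measure.pi_eq fun s hs => ?_).symm⟩
  rw [Measure.map_apply hm (MeasurableSet.univ_pi hs)]
  have h1 : (fun p : (∀ j, A j) × A i => Function.update p.1 i p.2) ⁻¹' Set.univ.pi s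
      = (Set.univ.pi (Function.update s i Set.univ)) ×ˢ s i := by
    ext ⟨w, y⟩
    simp only [Set.mem_preimage, Set.mem_pi, Set.mem_univ, true_imp_iff, Set.mem_prod]
    constructor
    · intro h
      refine ⟨fun j => ?_, by simpa using h i⟩
      by_cases hj : j = i
      · subst hj; simp
      · simpa [hj] using h j
    · rintro ⟨h, h'⟩ j
      by_cases hj : j = i
      · subst hj; simpa using h'
      · simpa [hj] using h j
  rw [h1, Measure.prod_prod, Measure.pi_pi,
    ← Finset.mul_prod_erase Finset.univ (fun j => μ j (Function.update s i Set.univ j))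
      (Finset.mem_univ i),
    ← Finset.mul_prod_erase Finset.univ (fun j => Function.update μ i ν j (s j))
      (Finset.mem_univ i)]
  simp only [Function.update_self, measure_univ, one_mul]
  rw [mul_comm]
  congr 1
  refine Finset.prod_congr rfl fun j hj => ?_
  rw [Function.update_of_ne (Finset.ne_of_mem_erase hj),
    Function.update_of_ne (Finset.ne_of_mem_erase hj)]

/-! ### The laws of the sampled and of the smoothing directions -/

section Laws

variable {n : ℕ} {d : Fin n → ℕ}

/-- The law of the sampled directions `v = (v_1, …, v_n)`. -/
def sphereLaw (d : Fin n → ℕ) : Measure (∀ j : Fin n, EuclideanSpace ℝ (Fin (d j))) :=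
  Measure.pi fun j => unifSphere (d j)

theorem smoothingLaw_eq (i : Fin n) : smoothingLaw d i
    = Measure.pi (Function.update (fun j => unifSphere (d j)) i (unifBall (d i))) := by
  rw [smoothingLaw]
  congr 1
  ext1 j
  by_cases h : j = i
  · subst h; simp
  · simp [h]

theorem measurePreserving_update_smoothingLaw (hd : ∀ i, 0 < d i) (i : Fin n) :
    MeasurePreserving (fun p : (∀ j : Fin n, EuclideanSpace ℝ (Fin (d j))) ×
      EuclideanSpace ℝ (Fin (d i)) => Function.update p.1 i p.2)
      ((sphereLaw d).prod (unifBall (d i))) (smoothingLaw d i) := by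
  have := fun j => isProbabilityMeasure_unifSphere (hd j)
  rw [smoothingLaw_eq]
  exact measurePreserving_update _ i _

theorem measurePreserving_update_sphereLaw (hd : ∀ i, 0 < d i) (i : Fin n) :
    MeasurePreserving (fun p : (∀ j : Fin n, EuclideanSpace ℝ (Fin (d j))) ×
      EuclideanSpace ℝ (Fin (d i)) => Function.update p.1 i p.2)
      ((sphereLaw d).prod (unifSphere (d i))) (sphereLaw d) := by
  have := fun j => isProbabilityMeasure_unifSphere (hd j)
  have h := measurePreserving_update (fun j => unifSphere (d j)) i (unifSphere (d i))
  rwa [Function.update_eq_self] at h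

theorem isProbabilityMeasure_sphereLaw (hd : ∀ i, 0 < d i) : IsProbabilityMeasure (sphereLaw d) := by
  have := fun j => isProbabilityMeasure_unifSphere (hd j)
  rw [sphereLaw]
  infer_instance

theorem isProbabilityMeasure_smoothingLaw (hd : ∀ i, 0 < d i) (i : Fin n) :
    IsProbabilityMeasure (smoothingLaw d i) := by
  have := isProbabilityMeasure_sphereLaw hd
  rw [← (measurePreserving_update_smoothingLaw hd i).map_eq]
  exact Measure.isProbabilityMeasure_map
    (measurePreserving_update_smoothingLaw hd i).measurable.aemeasurable

theorem ae_sphereLaw (hd : ∀ i, 0 < d i) : ∀ᵐ w ∂sphereLaw d, ∀ j, ‖w j‖ = 1 := by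
  have := fun j => isProbabilityMeasure_unifSphere (hd j)
  exact ae_all_iff.2 fun j =>
    (measurePreserving_eval (fun j => unifSphere (d j)) j).quasiMeasurePreserving.ae
      (ae_unifSphere (d j))

theorem ae_smoothingLaw (hd : ∀ i, 0 < d i) (i : Fin n) :
    ∀ᵐ w ∂smoothingLaw d i, ∀ j, ‖w j‖ ≤ 1 := by
  have := fun j => isProbabilityMeasure_unifSphere (hd j)
  have hp : ∀ j, IsProbabilityMeasure (if j = i then unifBall (d j) else unifSphere (d j)) := by
    intro j
    split_ifs <;> infer_instance
  refine ae_all_iff.2 fun j =>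
    (measurePreserving_eval (fun j => if j = i then unifBall (d j) else unifSphere (d j))
      j).quasiMeasurePreserving.ae (p := fun u => ‖u‖ ≤ 1) ?_
  split_ifs
  · exact (ae_unifBall (d j)).mono fun _ h => h.le
  · exact (ae_unifSphere (d j)).mono fun _ h => h.le

/-- Fubini after redrawing coordinate i. Taking σ on the sphere or on the ball puts the sampling law
and the smoothing law over the same outer measure, so that they can be compared with the other
coordinates frozen. -/
theorem integral_resample {ν : Measure (∀ j : Fin n, EuclideanSpace ℝ (Fin (d j)))}
    {μ : Measure (∀ j : Fin n, EuclideanSpace ℝ (Fin (d j)))} {i : Fin n}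
    {σ : Measure (EuclideanSpace ℝ (Fin (d i)))} [SFinite μ] [SFinite σ]
    (h : MeasurePreserving (fun p : (∀ j : Fin n, EuclideanSpace ℝ (Fin (d j))) ×
      EuclideanSpace ℝ (Fin (d i)) => Function.update p.1 i p.2) (μ.prod σ) ν)
    {F : (∀ j : Fin n, EuclideanSpace ℝ (Fin (d j))) → ℝ} (hF : Integrable F ν) :
    Integrable (fun w => ∫ y, F (Function.update w i y) ∂σ) μ ∧
      ∫ w, F w ∂ν = ∫ w, ∫ y, F (Function.update w i y) ∂σ ∂μ := by
  have h1 : Integrable (fun p : (∀ j : Fin n, EuclideanSpace ℝ (Fin (d j))) ×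
      EuclideanSpace ℝ (Fin (d i)) => F (Function.update p.1 i p.2)) (μ.prod σ) :=
    h.integrable_comp_of_integrable hF
  refine ⟨h1.integral_prod_left, ?_⟩
  conv_lhs => rw [← h.map_eq]
  rw [integral_map h.measurable.aemeasurable (by rw [h.map_eq]; exact hF.1), integral_prod _ h1]

theorem toLp_update (w : ∀ j : Fin n, EuclideanSpace ℝ (Fin (d j))) (i : Fin n)
    (y : EuclideanSpace ℝ (Fin (d i))) :
    (WithLp.toLp 2 (Function.update w i y) : Profile d) = deviate (WithLp.toLp 2 w) i y := rfl

theorem deviate_add_smul (x w : Profile d) (i : Fin n) (z u : EuclideanSpace ℝ (Fin (d i))) (δ : ℝ) :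
    deviate x i z + δ • deviate w i u = deviate (x + δ • w) i (z + δ • u) := by
  ext1 j
  by_cases h : j = i
  · subst h; simp
  · simp [deviate_of_ne _ h]

theorem add_smul_deviate (x w : Profile d) (i : Fin n) (u : EuclideanSpace ℝ (Fin (d i))) (δ : ℝ) :
    x + δ • deviate w i u = deviate (x + δ • w) i (x i + δ • u) := by
  rw [← deviate_add_smul, deviate_self]

theorem deviate_add (x w : Profile d) (i : Fin n) (z : EuclideanSpace ℝ (Fin (d i))) (δ : ℝ) :
    deviate x i z + δ • w = deviate (x + δ • w) i (z + δ • w i) := by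
  rw [← deviate_add_smul, deviate_self]

end Laws

/-- A game satisfying the standing assumptions, with a smoothing radius that keeps the queried
strategies feasible. -/
structure Smoothable {n : ℕ} {d : Fin n → ℕ} (X : ∀ i : Fin n, Set (EuclideanSpace ℝ (Fin (d i))))
    (f : Fin n → Profile d → ℝ) (α β L r R δ : ℝ) : Prop extends Standing X f α β L r R where
  dim_pos : ∀ i, 0 < d i
  delta_pos : 0 < δ
  delta_le_one : δ ≤ 1
  delta_small : 2 * L * (n : ℝ) ^ (3 / 2 : ℝ) * δ ≤ α
  query : ∀ i, ∀ y ∈ (1 - δ) • X i, ∀ u ∈ sphere (0 : EuclideanSpace ℝ (Fin (d i))) 1,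
    y + δ • u ∈ X i

/-- The pseudo-gradient of the smoothed game. -/
def smoothGrad {n : ℕ} {d : Fin n → ℕ} (X : ∀ i : Fin n, Set (EuclideanSpace ℝ (Fin (d i))))
    (f : Fin n → Profile d → ℝ) (δ : ℝ) (x : Profile d) : Profile d :=
  WithLp.toLp 2 fun i => ∫ w, partialGrad X f i (x + δ • WithLp.toLp 2 w) ∂(smoothingLaw d i)

/-- The shrunk strategy sets. -/
abbrev shrink {n : ℕ} {d : Fin n → ℕ} (X : ∀ i : Fin n, Set (EuclideanSpace ℝ (Fin (d i))))
    (δ : ℝ) (i : Fin n) : Set (EuclideanSpace ℝ (Fin (d i))) := (1 - δ) • X i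

/-! ### Bounds, measurability, and the shrunk strategy sets -/

namespace Standing

variable {n : ℕ} {d : Fin n → ℕ} {X : ∀ i : Fin n, Set (EuclideanSpace ℝ (Fin (d i)))}
  {f : Fin n → Profile d → ℝ} {α β L r R δ : ℝ}

theorem norm_le (hg : Standing X f α β L r R) {i : Fin n} {y : EuclideanSpace ℝ (Fin (d i))}
    (hy : y ∈ X i) : ‖y‖ ≤ R := by
  have h1 : deviate 0 i y ∈ prodSet X := deviate_mem (fun j => hg.zero_mem j) hy
  have h2 := hg.subset_ball h1
  rw [mem_closedBall_zero_iff] at h2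
  have h3 := Profile.norm_apply_le (deviate 0 i y) i
  rw [deviate_same] at h3
  exact h3.trans h2

theorem norm_sub_sq_le_const (hg : Standing X f α β L r R) {x y : Profile d}
    (hx : x ∈ prodSet X) (hy : y ∈ prodSet X) : ‖x - y‖ ^ 2 ≤ (R + R) ^ 2 := by
  have h1 := hg.subset_ball hx
  have h2 := hg.subset_ball hy
  rw [mem_closedBall_zero_iff] at h1 h2
  exact pow_le_pow_left₀ (norm_nonneg _) ((norm_sub_le _ _).trans (add_le_add h1 h2)) 2

theorem isCompact (hg : Standing X f α β L r R) (i : Fin n) : IsCompact (X i) :=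
  isCompact_of_isClosed_isBounded (hg.isClosed i)
    ((isBounded_closedBall (x := 0) (r := R)).subset fun y hy => by simpa using hg.norm_le hy)

theorem measurableSet_prodSet (hg : Standing X f α β L r R) : MeasurableSet (prodSet X) :=
  (isClosed_prodSet hg.isClosed).measurableSet

theorem norm_partialGrad_le (hg : Standing X f α β L r R) (i : Fin n) {x : Profile d}
    (hx : x ∈ prodSet X) : ‖partialGrad X f i x‖ ≤ ‖partialGrad X f i 0‖ + β * R := by
  have h1 := hg.grad_lipschitz i x hx 0 (fun j => hg.zero_mem j)
  have h2 := hg.subset_ball hx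
  rw [mem_closedBall_zero_iff] at h2
  rw [sub_zero] at h1
  have h3 := mul_le_mul_of_nonneg_left h2 hg.beta_nonneg
  have h4 := norm_sub_norm_le (partialGrad X f i x) (partialGrad X f i 0)
  linarith

theorem measurable_indicator_cost (hg : Standing X f α β L r R) (i : Fin n) :
    Measurable ((prodSet X).indicator (f i)) :=
  measurable_indicator_of_restrict hg.measurableSet_prodSet (hg.measurable i)

theorem measurable_indicator_partialGrad (hg : Standing X f α β L r R) (i : Fin n) :
    Measurable ((prodSet X).indicator (partialGrad X f i)) :=
  measurable_indicator_of_restrict hg.measurableSet_prodSet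
    (hg.grad_differentiable i).continuousOn.domRestrict.measurable

theorem cost_sq_le (hg : Standing X f α β L r R) (i : Fin n) {x : Profile d} (hx : x ∈ prodSet X) :
    |f i x| ^ 2 ≤ Fstar X f :=
  (le_ciSup (hg.bounded i) ⟨x, hx⟩).trans 
    (le_ciSup (f := fun i => ⨆ x : prodSet X, |f i x| ^ 2) (Set.finite_range _).bddAbove i)

theorem Fstar_nonneg : 0 ≤ Fstar X f :=
  Real.iSup_nonneg fun _ => Real.iSup_nonneg fun _ => by positivity

theorem abs_cost_le (hg : Standing X f α β L r R) (i : Fin n) {x : Profile d} (hx : x ∈ prodSet X) :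
    |f i x| ≤ Real.sqrt (Fstar X f) :=
  Real.le_sqrt_of_sq_le (hg.cost_sq_le i hx)

theorem convex_shrink (hg : Standing X f α β L r R) (i : Fin n) : Convex ℝ (shrink X δ i) :=
  (hg.convex i).smul _

/-- Compactness is used because δ = 1 is allowed, and scaling by 0 need not preserve closedness in
general. -/
theorem isClosed_shrink (hg : Standing X f α β L r R) (i : Fin n) : IsClosed (shrink X δ i) :=
  ((hg.isCompact i).smul _).isClosed

theorem zero_mem_shrink (hg : Standing X f α β L r R) (i : Fin n) :
    (0 : EuclideanSpace ℝ (Fin (d i))) ∈ shrink X δ i :=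
  ⟨0, hg.zero_mem i, by simp⟩

end Standing

/-! ### The smoothed game and its pseudo-gradient -/

namespace Smoothable

variable {n : ℕ} {d : Fin n → ℕ} {X : ∀ i : Fin n, Set (EuclideanSpace ℝ (Fin (d i)))}
  {f : Fin n → Profile d → ℝ} {α β L r R δ : ℝ}

theorem shrink_subset (hs : Smoothable X f α β L r R δ) (i : Fin n) : shrink X δ i ⊆ X i := by
  rintro _ ⟨y, hy, rfl⟩
  exact (hs.convex i).smul_mem_of_zero_mem (hs.zero_mem i) hy
    ⟨by linarith [hs.delta_le_one], by linarith [hs.delta_pos]⟩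

theorem prodSet_shrink_subset (hs : Smoothable X f α β L r R δ) :
    prodSet (shrink X δ) ⊆ prodSet X := fun _ hx i => hs.shrink_subset i (hx i)

/-- The query condition covers unit vectors. A shorter nonzero u gives a point of the segment from y
to the query in its direction. -/
theorem add_smul_mem (hs : Smoothable X f α β L r R δ) {i : Fin n}
    {y u : EuclideanSpace ℝ (Fin (d i))} (hy : y ∈ shrink X δ i) (hu : ‖u‖ ≤ 1) :
    y + δ • u ∈ X i := by
  rcases eq_or_ne u 0 with rfl | h0
  · simpa using hs.shrink_subset i hy
  · have h1 : y + δ • ‖u‖⁻¹ • u ∈ X i := hs.query i y hy _ (by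
      simp [norm_smul, inv_mul_cancel₀ (norm_ne_zero_iff.2 h0)])
    have h2 := (hs.convex i).add_smul_sub_mem (hs.shrink_subset i hy) h1 ⟨norm_nonneg u, hu⟩
    rwa [add_sub_cancel_left, smul_comm ‖u‖ δ, smul_smul ‖u‖, mul_inv_cancel₀ (norm_ne_zero_iff.2 h0),
      one_smul] at h2

theorem add_smul_mem_prodSet (hs : Smoothable X f α β L r R δ) {x w : Profile d}
    (hx : x ∈ prodSet (shrink X δ)) (hw : ∀ j, ‖w j‖ ≤ 1) : x + δ • w ∈ prodSet X :=
  fun i => hs.add_smul_mem (hx i) (hw i)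

theorem integrable_comp {F : Type*} [NormedAddCommGroup F] [MeasurableSpace F] [BorelSpace F]
    [SecondCountableTopology F] (hs : Smoothable X f α β L r R δ)
    {μ : Measure (∀ j : Fin n, EuclideanSpace ℝ (Fin (d j)))} [IsFiniteMeasure μ]
    (hμ : ∀ᵐ w ∂μ, ∀ j, ‖w j‖ ≤ 1) {φ : Profile d → F} {C : ℝ}
    (hφ : Measurable ((prodSet X).indicator φ)) (hC : ∀ z ∈ prodSet X, ‖φ z‖ ≤ C) {x : Profile d}
    (hx : x ∈ prodSet (shrink X δ)) : Integrable (fun w => φ (x + δ • WithLp.toLp 2 w)) μ := by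
  have hmem : ∀ᵐ w ∂μ, x + δ • (WithLp.toLp 2 w : Profile d) ∈ prodSet X :=
    hμ.mono fun w hw => hs.add_smul_mem_prodSet hx hw
  have hm : Measurable fun w : ∀ j : Fin n, EuclideanSpace ℝ (Fin (d j)) =>
      (prodSet X).indicator φ (x + δ • WithLp.toLp 2 w) := hφ.comp (by fun_prop)
  refine Integrable.of_bound (C := C) (hm.aestronglyMeasurable.congr ?_) ?_
  · filter_upwards [hmem] with w hw using Set.indicator_of_mem hw _
  · filter_upwards [hmem] with w hw using hC _ hw

theorem integrable_cost (hs : Smoothable X f α β L r R δ)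
    {μ : Measure (∀ j : Fin n, EuclideanSpace ℝ (Fin (d j)))} [IsFiniteMeasure μ]
    (hμ : ∀ᵐ w ∂μ, ∀ j, ‖w j‖ ≤ 1) (i : Fin n) {x : Profile d} (hx : x ∈ prodSet (shrink X δ)) :
    Integrable (fun w => f i (x + δ • WithLp.toLp 2 w)) μ :=
  hs.integrable_comp hμ (hs.measurable_indicator_cost i) (fun _ hz => hs.abs_cost_le i hz) hx

theorem integrable_partialGrad (hs : Smoothable X f α β L r R δ)
    {μ : Measure (∀ j : Fin n, EuclideanSpace ℝ (Fin (d j)))} [IsFiniteMeasure μ]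
    (hμ : ∀ᵐ w ∂μ, ∀ j, ‖w j‖ ≤ 1) (i : Fin n) {x : Profile d} (hx : x ∈ prodSet (shrink X δ)) :
    Integrable (fun w => partialGrad X f i (x + δ • WithLp.toLp 2 w)) μ :=
  hs.integrable_comp hμ (hs.measurable_indicator_partialGrad i)
    (fun _ hz => hs.norm_partialGrad_le i hz) hx

theorem inner_smoothGrad (hs : Smoothable X f α β L r R δ) (i : Fin n) {x : Profile d}
    (hx : x ∈ prodSet (shrink X δ)) (v : EuclideanSpace ℝ (Fin (d i))) :
    inner ℝ (smoothGrad X f δ x i) v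
      = ∫ w, inner ℝ (partialGrad X f i (x + δ • WithLp.toLp 2 w)) v ∂(smoothingLaw d i) := by
  have := isProbabilityMeasure_smoothingLaw hs.dim_pos i
  rw [real_inner_comm]
  refine (integral_inner (hs.integrable_partialGrad (ae_smoothingLaw hs.dim_pos i) i hx) v).symm.trans ?_
  exact integral_congr_ae (.of_forall fun w => real_inner_comm _ _)

/-- The tangent inequality of f_i at x + δw is averaged: both points are shifted by δw_i, so the
displacement z - x_i does not depend on w. This makes `smoothGrad` a pseudo-gradient without
differentiating under the integral. -/
theorem smoothed_tangent_le (hs : Smoothable X f α β L r R δ) (i : Fin n) {x : Profile d}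
    (hx : x ∈ prodSet (shrink X δ)) {z : EuclideanSpace ℝ (Fin (d i))} (hz : z ∈ shrink X δ i) :
    smoothed f δ i x + inner ℝ (smoothGrad X f δ x i) (z - x i) ≤ smoothed f δ i (deviate x i z) := by
  have := isProbabilityMeasure_smoothingLaw hs.dim_pos i
  have hμ := ae_smoothingLaw hs.dim_pos i
  have hpi : Integrable (fun w => inner ℝ (partialGrad X f i (x + δ • WithLp.toLp 2 w)) (z - x i))
      (smoothingLaw d i) := (hs.integrable_partialGrad hμ i hx).inner_const (z - x i)
  rw [hs.inner_smoothGrad i hx, smoothed, smoothed, ← integral_add (hs.integrable_cost hμ i hx) hpi]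
  refine integral_mono_ae ((hs.integrable_cost hμ i hx).add hpi)
    (hs.integrable_cost hμ i (deviate_mem hx hz)) ?_
  filter_upwards [hμ] with w hw
  have h1 := hs.tangent_add_sq_le (hs.add_smul_mem_prodSet (w := WithLp.toLp 2 w) hx hw)
    (hs.add_smul_mem hz (hw i))
  have h2 : 0 ≤ α / 2 * ‖z + δ • w i - (x + δ • WithLp.toLp 2 w : Profile d) i‖ ^ 2 := by
    have := hs.alpha_pos; positivity
  have h3 : z + δ • w i - (x + δ • WithLp.toLp 2 w : Profile d) i = z - x i := by simp
  rw [deviate_add]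
  rw [h3] at h1 h2
  linarith

theorem norm_smoothGrad_sub_le (hs : Smoothable X f α β L r R δ) {x y : Profile d}
    (hx : x ∈ prodSet (shrink X δ)) (hy : y ∈ prodSet (shrink X δ)) :
    ‖smoothGrad X f δ x - smoothGrad X f δ y‖ ≤ β * Real.sqrt n * ‖x - y‖ := by
  have h := Profile.norm_le_sqrt_mul (x := smoothGrad X f δ x - smoothGrad X f δ y)
    (mul_nonneg hs.beta_nonneg (norm_nonneg (x - y))) fun i => by
      have := isProbabilityMeasure_smoothingLaw hs.dim_pos i
      have hμ := ae_smoothingLaw hs.dim_pos i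
      rw [PiLp.sub_apply, smoothGrad, smoothGrad]
      simp only
      rw [← integral_sub (hs.integrable_partialGrad hμ i hx) (hs.integrable_partialGrad hμ i hy)]
      refine (norm_integral_le_of_norm_le_const (C := β * ‖x - y‖) ?_).trans_eq (by simp)
      filter_upwards [hμ] with w hw
      have h1 := hs.grad_lipschitz i _ (hs.add_smul_mem_prodSet (w := WithLp.toLp 2 w) hx hw)
        _ (hs.add_smul_mem_prodSet (w := WithLp.toLp 2 w) hy hw)
      rwa [add_sub_add_right_eq_sub] at h1
  linarith

/-- One √n comes from ‖w‖ ≤ √n inside each block, the other from assembling n blocks. -/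
theorem norm_smoothGrad_sub_gameGrad_le (hs : Smoothable X f α β L r R δ) {x : Profile d}
    (hx : x ∈ prodSet (shrink X δ)) :
    ‖smoothGrad X f δ x - gameGrad X f x‖ ≤ β * δ * n := by
  have h := Profile.norm_le_sqrt_mul (x := smoothGrad X f δ x - gameGrad X f x)
    (c := β * (δ * Real.sqrt n))
    (by have := hs.beta_nonneg; have := hs.delta_pos; positivity) fun i => by
      have := isProbabilityMeasure_smoothingLaw hs.dim_pos i
      have hμ := ae_smoothingLaw hs.dim_pos i
      have hc : ∫ _w, partialGrad X f i x ∂(smoothingLaw d i) = gameGrad X f x i := by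
        simp [gameGrad]
      rw [PiLp.sub_apply, ← hc, smoothGrad]
      simp only
      rw [← integral_sub (hs.integrable_partialGrad hμ i hx) (integrable_const _)]
      refine (norm_integral_le_of_norm_le_const (C := β * (δ * Real.sqrt n)) ?_).trans_eq (by simp)
      filter_upwards [hμ] with w hw
      have h1 := hs.grad_lipschitz i _ (hs.add_smul_mem_prodSet (w := WithLp.toLp 2 w) hx hw)
        _ (hs.prodSet_shrink_subset hx)
      refine h1.trans (mul_le_mul_of_nonneg_left ?_ hs.beta_nonneg)
      rw [add_sub_cancel_left, norm_smul, Real.norm_of_nonneg hs.delta_pos.le]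
      refine mul_le_mul_of_nonneg_left ?_ hs.delta_pos.le
      simpa using Profile.norm_le_sqrt_mul (x := WithLp.toLp 2 w) zero_le_one hw
  refine h.trans_eq ?_
  linear_combination (β * δ) * Real.mul_self_sqrt (Nat.cast_nonneg n)

/-- Each block averages over its own law, so `smoothGrad` is not an average of g and does not simply
inherit monotonicity. Instead, the mixed-difference bound compares its increments with those of g:
the error is Lδ√n‖x-y‖ per block and Lδn‖x-y‖ in total, which is at most (α/2)‖x-y‖ because n ≤
n^(3/2). -/
theorem strongly_monotone_smoothGrad (hs : Smoothable X f α β L r R δ) :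
    ∀ x ∈ prodSet (shrink X δ), ∀ y ∈ prodSet (shrink X δ),
      α / 2 * ‖x - y‖ ^ 2 ≤ inner ℝ (smoothGrad X f δ x - smoothGrad X f δ y) (x - y) := by
  intro x hx y hy
  have hL := hs.L_nonneg
  have hδ := hs.delta_pos
  have hdiff := Profile.norm_le_sqrt_mul
    (x := (smoothGrad X f δ x - smoothGrad X f δ y) - (gameGrad X f x - gameGrad X f y))
    (c := L * (δ * Real.sqrt n) * ‖x - y‖) (by positivity) fun i => by
      have := isProbabilityMeasure_smoothingLaw hs.dim_pos i
      have hμ := ae_smoothingLaw hs.dim_pos i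
      have hc : ∫ _w, (partialGrad X f i x - partialGrad X f i y) ∂(smoothingLaw d i)
          = gameGrad X f x i - gameGrad X f y i := by
        simp [gameGrad]
      rw [PiLp.sub_apply, PiLp.sub_apply, PiLp.sub_apply, ← hc, smoothGrad, smoothGrad]
      simp only
      have hi := (hs.integrable_partialGrad hμ i hx)
      have hi' := (hs.integrable_partialGrad hμ i hy)
      rw [← integral_sub hi hi', ← integral_sub (by exact hi.sub hi') (integrable_const _)]
      refine (norm_integral_le_of_norm_le_const
        (C := L * (δ * Real.sqrt n) * ‖x - y‖) ?_).trans_eq (by simp)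
      filter_upwards [hμ] with w hw
      have h1 := hs.norm_partialGrad_mixed_sub_le i (convex_prodSet fun i => hs.convex_shrink i)
        hs.prodSet_shrink_subset (w := δ • WithLp.toLp 2 w)
        (fun z hz => hs.add_smul_mem_prodSet hz hw) hx hy
      refine h1.trans (mul_le_mul_of_nonneg_right (mul_le_mul_of_nonneg_left ?_ hL) (norm_nonneg _))
      rw [norm_smul, Real.norm_of_nonneg hδ.le]
      refine mul_le_mul_of_nonneg_left ?_ hδ.le
      simpa using Profile.norm_le_sqrt_mul (x := WithLp.toLp 2 w) zero_le_one hw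
  have hn : 2 * (L * δ * n) ≤ α := by
    refine le_trans ?_ hs.delta_small
    have h1 : (n : ℝ) ≤ (n : ℝ) ^ (3 / 2 : ℝ) := by
      rcases Nat.eq_zero_or_pos n with rfl | hn
      · simp
      · exact Real.self_le_rpow_of_one_le (by exact_mod_cast hn) (by norm_num)
    have h2 := mul_le_mul_of_nonneg_left h1 (show 0 ≤ 2 * L * δ by positivity)
    linarith
  have h1 := hs.strongly_monotone x (hs.prodSet_shrink_subset hx) y (hs.prodSet_shrink_subset hy)
  have h2 := real_inner_le_norm
    ((gameGrad X f x - gameGrad X f y) - (smoothGrad X f δ x - smoothGrad X f δ y)) (x - y)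
  rw [norm_sub_rev, inner_sub_left] at h2
  have h3 := mul_le_mul_of_nonneg_right hdiff (norm_nonneg (x - y))
  have h4 : Real.sqrt n * (L * (δ * Real.sqrt n) * ‖x - y‖) * ‖x - y‖
      = L * δ * n * ‖x - y‖ ^ 2 := by
    linear_combination (L * δ * ‖x - y‖ ^ 2) * Real.mul_self_sqrt (Nat.cast_nonneg n)
  have h5 := mul_le_mul_of_nonneg_right hn (sq_nonneg ‖x - y‖)
  linarith

theorem isNash_smoothed_iff (hs : Smoothable X f α β L r R δ) {x : Profile d} :
    IsNash (shrink X δ) (smoothed f δ) x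
      ↔ IsVISol (prodSet (shrink X δ)) (smoothGrad X f δ) x :=
  isNash_iff_isVISol (fun i => hs.convex_shrink i) (fun _ hx _ hy => hs.norm_smoothGrad_sub_le hx hy)
    fun i _ hx _ hz => hs.smoothed_tangent_le i hx hz

theorem existsUnique_isNash_smoothed (hs : Smoothable X f α β L r R δ) :
    ∃! x, IsNash (shrink X δ) (smoothed f δ) x := by
  have hα : 0 < α / 2 := half_pos hs.alpha_pos
  obtain ⟨x, hx⟩ := exists_isVISol hα
    (K := prodSet (shrink X δ)) ⟨0, fun i => hs.zero_mem_shrink i⟩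
    (isClosed_prodSet fun i => hs.isClosed_shrink i) (convex_prodSet fun i => hs.convex_shrink i)
    hs.strongly_monotone_smoothGrad (fun _ hx _ hy => hs.norm_smoothGrad_sub_le hx hy)
  exact ⟨x, hs.isNash_smoothed_iff.2 hx, fun y hy =>
    IsVISol.unique hα hs.strongly_monotone_smoothGrad (hs.isNash_smoothed_iff.1 hy) hx⟩

theorem integrable_cost_mul_inner (hs : Smoothable X f α β L r R δ) (i : Fin n) {x : Profile d}
    (hx : x ∈ prodSet (shrink X δ)) (v : EuclideanSpace ℝ (Fin (d i))) :
    Integrable (fun w => f i (x + δ • WithLp.toLp 2 w) * inner ℝ (w i) v) (sphereLaw d) := by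
  have := isProbabilityMeasure_sphereLaw hs.dim_pos
  have hσ : ∀ᵐ w ∂(sphereLaw d), ∀ j, ‖w j‖ ≤ 1 :=
    (ae_sphereLaw hs.dim_pos).mono fun w hw j => (hw j).le
  refine (hs.integrable_cost hσ i hx).mul_bdd (c := ‖v‖)
    (((measurable_pi_apply i).inner measurable_const).aestronglyMeasurable) ?_
  filter_upwards [hσ] with w hw
  refine (norm_inner_le_norm _ _).trans ?_
  exact mul_le_of_le_one_left (norm_nonneg _) (hw i)

/-- The single-point estimate is an unbiased estimate of the pseudo-gradient of the smoothed
game. -/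
theorem integral_cost_mul_inner (hs : Smoothable X f α β L r R δ) (i : Fin n) {x : Profile d}
    (hx : x ∈ prodSet (shrink X δ)) (v : EuclideanSpace ℝ (Fin (d i))) :
    d i / δ * ∫ w, f i (x + δ • WithLp.toLp 2 w) * inner ℝ (w i) v ∂(sphereLaw d)
      = inner ℝ (smoothGrad X f δ x i) v := by
  have := isProbabilityMeasure_sphereLaw hs.dim_pos
  have := isProbabilityMeasure_smoothingLaw hs.dim_pos i
  have := isProbabilityMeasure_unifSphere (hs.dim_pos i)
  have hμ := ae_smoothingLaw hs.dim_pos i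
  have hσ : ∀ᵐ w ∂(sphereLaw d), ∀ j, ‖w j‖ ≤ 1 :=
    (ae_sphereLaw hs.dim_pos).mono fun w hw j => (hw j).le
  have hball := measurePreserving_update_smoothingLaw hs.dim_pos i
  have hsph := measurePreserving_update_sphereLaw hs.dim_pos i
  have hi2 : Integrable (fun w => inner ℝ (partialGrad X f i (x + δ • WithLp.toLp 2 w)) v)
      (smoothingLaw d i) := (hs.integrable_partialGrad hμ i hx).inner_const v
  -- Redrawing coordinate i, over the sphere for the estimate and over the ball for the gradient,
  -- leaves inner integrals that agree for almost every w by the divergence theorem.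
  have e1 := (integral_resample hsph (hs.integrable_cost_mul_inner i hx v)).2
  have e2 := (integral_resample hball hi2).2
  simp only [Function.update_self] at e1
  rw [hs.inner_smoothGrad i hx, e1, e2, ← integral_const_mul]
  refine integral_congr_ae ?_
  filter_upwards [hσ] with w hw
  have hxw := hs.add_smul_mem_prodSet (w := WithLp.toLp 2 w) hx hw
  simp only [toLp_update, add_smul_deviate]
  exact (integral_inner_gradient_unifBall (hs.dim_pos i) (s := X i) hs.delta_pos
    (G := fun y => partialGrad X f i (deviate (x + δ • WithLp.toLp 2 w) i y))
    (f := fun y => f i (deviate (x + δ • WithLp.toLp 2 w) i y))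
    (fun u hu => hs.add_smul_mem (hx i) hu) (fun z hz => hs.hasGradientWithinAt hxw hz)
    (fun z hz => hs.norm_partialGrad_le i (deviate_mem hxw hz)) v).symm

end Smoothable

/-- On the sphere of a line, the average of `h(y + δ u) ⟨u, e⟩` is a central difference. -/
theorem integral_unifSphere_of_dim_eq_one {m : ℕ} (hm : m = 1) (h : EuclideanSpace ℝ (Fin m) → ℝ)
    (y : EuclideanSpace ℝ (Fin m)) (δ : ℝ) {e : EuclideanSpace ℝ (Fin m)} (he : ‖e‖ = 1) :
    ∫ u, h (y + δ • u) * inner ℝ u e ∂unifSphere m = (h (y + δ • e) - h (y - δ • e)) / 2 := by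
  have hm0 : 0 < m := by omega
  have := isProbabilityMeasure_unifSphere hm0
  -- The divergence theorem for a constant function.
  have hzero : ∫ u, inner ℝ u e ∂unifSphere m = 0 := by
    have h1 := integral_lineDeriv_unifBall hm0
      (LipschitzWith.const (α := EuclideanSpace ℝ (Fin m)) (1 : ℝ)) e
    have h2 : ∀ x : EuclideanSpace ℝ (Fin m), lineDeriv ℝ (fun _ => (1 : ℝ)) x e = 0 :=
      fun x => (hasDerivAt_const (0 : ℝ) (1 : ℝ)).deriv
    simp only [h2, integral_zero, one_mul] at h1
    have h3 : (m : ℝ) ≠ 0 := by exact_mod_cast hm0.ne'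
    exact (mul_eq_zero.1 h1.symm).resolve_left h3
  have hint : Integrable (fun u => inner ℝ u e) (unifSphere m) := by
    refine Integrable.of_bound (C := 1)
      (measurable_id.inner measurable_const).aestronglyMeasurable ?_
    filter_upwards [ae_unifSphere m] with u hu
    simpa [hu, he] using norm_inner_le_norm (𝕜 := ℝ) u e
  -- On a line the sphere is {e, -e}, so ⟨u, e⟩ = ±1 and the integrand is affine in ⟨u, e⟩.
  have heq : ∀ᵐ u ∂unifSphere m, h (y + δ • u) * inner ℝ u e
      = (h (y + δ • e) + h (y - δ • e)) / 2 * inner ℝ u e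
        + (h (y + δ • e) - h (y - δ • e)) / 2 := by
    filter_upwards [ae_unifSphere m] with u hu
    have he0 : e ≠ 0 := norm_ne_zero_iff.1 (by rw [he]; exact one_ne_zero)
    obtain ⟨c, rfl⟩ := (finrank_eq_one_iff_of_nonzero' (K := ℝ) e he0).1
      (by rw [finrank_euclideanSpace_fin, hm]) u
    rw [norm_smul, he, mul_one, Real.norm_eq_abs] at hu
    rw [real_inner_smul_left, real_inner_self_eq_norm_sq, he]
    rcases eq_or_eq_neg_of_abs_eq hu with rfl | rfl
    · rw [one_smul]; ring
    · rw [neg_smul, one_smul, smul_neg, ← sub_eq_add_neg]; ring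
  rw [integral_congr_ae heq, integral_add (hint.const_mul _) (integrable_const _),
    integral_const_mul, hzero]
  simp

/-! ### Distance between the equilibria, and size of the shrunk sets -/

namespace Smoothable

variable {n : ℕ} {d : Fin n → ℕ} {X : ∀ i : Fin n, Set (EuclideanSpace ℝ (Fin (d i)))}
  {f : Fin n → Profile d → ℝ} {α β L r R δ : ℝ}

/-- The point z = (1-δ)x* is admissible in the smoothed inequality, and xd = (1-δ)y with y
admissible in the original one. Both inequalities then have the favourable sign in ⟨g(z) - g(xd), z
- xd⟩, leaving α‖z-xd‖ ≤ β√n·δ‖x*‖ + βδn. -/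
theorem norm_equilibrium_sub_le (hs : Smoothable X f α β L r R δ) {xs xd : Profile d}
    (hxs : IsNash X f xs) (hxd : IsNash (shrink X δ) (smoothed f δ) xd) :
    ‖xd - xs‖ ≤ δ * ((1 + β * Real.sqrt n / α) * ‖xs‖ + β * n / α) := by
  have hα := hs.alpha_pos
  have hδ := hs.delta_pos
  rw [hs.isNash_iff] at hxs
  rw [hs.isNash_smoothed_iff] at hxd
  set z := (1 - δ) • xs with hz
  have hzK : z ∈ prodSet (shrink X δ) := fun i => ⟨xs i, hxs.1 i, rfl⟩
  obtain ⟨y, hyX, hy⟩ : ∃ y ∈ prodSet X, xd = (1 - δ) • y := by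
    choose y hy1 hy2 using hxd.1
    exact ⟨WithLp.toLp 2 y, hy1, by ext1 i; exact (hy2 i).symm⟩
  have hzxs : ‖z - xs‖ = δ * ‖xs‖ := by
    have : z - xs = -(δ • xs) := by rw [hz, sub_smul, one_smul]; abel
    rw [this, norm_neg, norm_smul, Real.norm_of_nonneg hδ.le]
  have h1 := hs.strongly_monotone z (hs.prodSet_shrink_subset hzK) xd
    (hs.prodSet_shrink_subset hxd.1)
  have h2 := real_inner_le_norm (gameGrad X f z - gameGrad X f xs) (z - xd)
  have h3 := mul_le_mul_of_nonneg_right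
    (hs.norm_gameGrad_sub_le (hs.prodSet_shrink_subset hzK) hxs.1) (norm_nonneg (z - xd))
  have h4 := real_inner_le_norm (smoothGrad X f δ xd - gameGrad X f xd) (z - xd)
  have h5 := mul_le_mul_of_nonneg_right (hs.norm_smoothGrad_sub_gameGrad_le hxd.1)
    (norm_nonneg (z - xd))
  have h6 := hxd.2 z hzK
  have h7 : inner ℝ (gameGrad X f xs) (z - xd) ≤ 0 := by
    have h8 := hxs.2 y hyX
    have h9 : z - xd = -((1 - δ) • (y - xs)) := by rw [hy, hz, smul_sub]; abel
    rw [h9, inner_neg_right, real_inner_smul_right, neg_nonpos]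
    exact mul_nonneg (by linarith [hs.delta_le_one]) h8
  rw [inner_sub_left] at h1 h2 h4
  rw [hzxs] at h3
  have h10 : α * ‖z - xd‖ ≤ β * Real.sqrt n * (δ * ‖xs‖) + β * δ * n := by
    rcases (norm_nonneg (z - xd)).eq_or_lt with h0 | h0
    · rw [← h0]
      have := hs.beta_nonneg
      simp only [mul_zero]
      positivity
    · refine le_of_mul_le_mul_right ?_ h0
      linarith
  have h11 : ‖z - xd‖ ≤ (β * Real.sqrt n * (δ * ‖xs‖) + β * δ * n) / α := by
    rw [le_div_iff₀ hα]; linarith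
  have h12 : ‖xd - xs‖ ≤ ‖z - xd‖ + ‖z - xs‖ := by
    rw [norm_sub_rev z xd]; exact norm_sub_le_norm_sub_add_norm_sub _ _ _
  rw [hzxs] at h12
  refine (h12.trans (add_le_add_left h11 _)).trans_eq ?_
  field_simp
  ring

/-- The query condition sends y ∈ X_i to (1-δ)y + δu ∈ X_i. Iterating from 0 gives (1-(1-δ)^k)u,
which tends to u. -/
theorem mem_of_norm_eq_one (hs : Smoothable X f α β L r R δ) {i : Fin n}
    {u : EuclideanSpace ℝ (Fin (d i))} (hu : ‖u‖ = 1) : u ∈ X i := by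
  have h1 : ∀ k : ℕ, (1 - (1 - δ) ^ k) • u ∈ X i := by
    intro k
    induction k with
    | zero => simpa using hs.zero_mem i
    | succ k ih =>
      have h2 := hs.query i _ (Set.smul_mem_smul_set ih) u (by simpa using hu)
      rw [smul_smul, ← add_smul] at h2
      convert h2 using 2
      ring
  have h2 : Filter.Tendsto (fun k : ℕ => (1 - (1 - δ) ^ k) • u) Filter.atTop (nhds u) := by
    have h3 := tendsto_pow_atTop_nhds_zero_of_lt_one (r := 1 - δ) (by linarith [hs.delta_le_one])
      (by linarith [hs.delta_pos])
    simpa using (h3.const_sub 1).smul_const u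
  exact (hs.isClosed i).mem_of_tendsto h2 (.of_forall h1)

/-- Strong convexity at the midpoint: the two tangent terms cancel, and the costs at the three
points are at most √F_* in absolute value. -/
theorem alpha_mul_sq_le (hs : Smoothable X f α β L r R δ) {i : Fin n}
    {y z : EuclideanSpace ℝ (Fin (d i))} (hy : y ∈ X i) (hz : z ∈ X i) :
    α * ‖y - z‖ ^ 2 ≤ 16 * Real.sqrt (Fstar X f) := by
  set m : EuclideanSpace ℝ (Fin (d i)) := (1 / 2 : ℝ) • y + (1 / 2 : ℝ) • z with hm
  have hmX : m ∈ X i := hs.convex i hy hz (by norm_num) (by norm_num) (by norm_num)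
  have h0 : (0 : Profile d) ∈ prodSet X := fun j => hs.zero_mem j
  have hp : deviate 0 i m ∈ prodSet X := deviate_mem h0 hmX
  have h1 := hs.tangent_add_sq_le hp hy
  have h2 := hs.tangent_add_sq_le hp hz
  rw [deviate_same, deviate_deviate] at h1 h2
  have e1 : y - m = (1 / 2 : ℝ) • (y - z) := by
    rw [hm]; module
  have e2 : z - m = -((1 / 2 : ℝ) • (y - z)) := by
    rw [hm]; module
  rw [e2, inner_neg_right, norm_neg, norm_smul] at h2
  rw [e1, norm_smul] at h1
  have h3 := abs_le.1 (hs.abs_cost_le i hp)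
  have h4 := abs_le.1 (hs.abs_cost_le i (deviate_mem (i := i) h0 hy))
  have h5 := abs_le.1 (hs.abs_cost_le i (deviate_mem (i := i) h0 hz))
  norm_num at h1 h2
  linarith

/-- Antipodal unit vectors of X_i give 4α ≤ 16√F_*. Together with α‖y-z‖² ≤ 16√F_* in X_i this
yields α‖y-z‖ ≤ 8√F_*, and shrinking brings in the factor δ(1-δ) ≤ 1/4. -/
theorem norm_sub_le_sqrt_Fstar (hs : Smoothable X f α β L r R δ) {i : Fin n}
    {y z : EuclideanSpace ℝ (Fin (d i))} (hy : y ∈ shrink X δ i) (hz : z ∈ shrink X δ i) :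
    α * δ * ‖y - z‖ ≤ 2 * Real.sqrt (Fstar X f) := by
  obtain ⟨y, hy, rfl⟩ := hy
  obtain ⟨z, hz, rfl⟩ := hz
  have h1 := hs.alpha_mul_sq_le hy hz
  have h2 : α * 2 ^ 2 ≤ 16 * Real.sqrt (Fstar X f) := by
    set u : EuclideanSpace ℝ (Fin (d i)) := EuclideanSpace.single ⟨0, hs.dim_pos i⟩ 1 with hu
    have hu1 : ‖u‖ = 1 := by simp [hu]
    have h3 := hs.alpha_mul_sq_le (hs.mem_of_norm_eq_one hu1)
      (hs.mem_of_norm_eq_one (u := -u) (by rwa [norm_neg]))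
    rwa [sub_neg_eq_add, ← two_smul ℝ u, norm_smul, hu1, mul_one, Real.norm_of_nonneg zero_le_two]
      at h3
  have hα := hs.alpha_pos
  simp only [← smul_sub]
  rw [norm_smul, Real.norm_of_nonneg (by linarith [hs.delta_le_one])]
  have h3 : δ * (1 - δ) ≤ 1 / 4 := by nlinarith [sq_nonneg (2 * δ - 1)]
  have h4 := mul_le_mul_of_nonneg_right h3 (mul_nonneg hα.le (norm_nonneg (y - z)))
  have h5 := mul_nonneg hα.le (sq_nonneg (‖y - z‖ - 2))
  nlinarith

/-- Squaring the diameter bound gives 4F_*, whereas one player on a line needs at most 2F_* at t =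
2. The gain comes from equilibrium: the mean central difference of the cost at xd towards z is
nonnegative, so strong convexity makes the cost grow quadratically all the way to the query point z
+ δe. -/
theorem norm_sub_equilibrium_le_of_dim_eq_one (hs : Smoothable X f α β L r R δ) {i : Fin n}
    (hi : d i = 1) {xd : Profile d} (hxd : IsNash (shrink X δ) (smoothed f δ) xd)
    {z : EuclideanSpace ℝ (Fin (d i))} (hz : z ∈ shrink X δ i) :
    α * δ * ‖z - xd i‖ ≤ Real.sqrt (Fstar X f) := by
  have hα := hs.alpha_pos
  have hδ := hs.delta_pos
  rw [hs.isNash_smoothed_iff] at hxd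
  have := isProbabilityMeasure_sphereLaw hs.dim_pos
  have := isProbabilityMeasure_unifSphere (hs.dim_pos i)
  set M := Real.sqrt (Fstar X f) with hM
  set a := ‖z - xd i‖ with ha
  rcases (norm_nonneg (z - xd i)).eq_or_lt with h0 | h0
  · rw [ha, ← h0, mul_zero]; exact Real.sqrt_nonneg _
  rw [← ha] at h0
  set e := a⁻¹ • (z - xd i) with he
  have he1 : ‖e‖ = 1 := by
    rw [he, norm_smul, norm_inv, ← ha, Real.norm_of_nonneg h0.le, inv_mul_cancel₀ h0.ne']
  have hze : z = xd i + a • e := by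
    rw [he, smul_smul, mul_inv_cancel₀ h0.ne', one_smul, add_sub_cancel]
  set J : (∀ j : Fin n, EuclideanSpace ℝ (Fin (d j))) → ℝ := fun w =>
    ∫ y, f i (xd + δ • WithLp.toLp 2 (Function.update w i y)) * inner ℝ y e ∂unifSphere (d i)
    with hJ
  have hres := integral_resample (measurePreserving_update_sphereLaw hs.dim_pos i)
    (hs.integrable_cost_mul_inner i hxd.1 e)
  simp only [Function.update_self] at hres
  have hJ0 : 0 ≤ ∫ w, J w ∂sphereLaw d := by
    have h1 := hs.integral_cost_mul_inner i hxd.1 e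
    rw [hres.2] at h1
    have h2 := hxd.2 _ (deviate_mem (i := i) hxd.1 hz)
    rw [inner_deviate_sub] at h2
    have h3 : 0 ≤ inner ℝ (smoothGrad X f δ xd i) e := by
      rw [he, real_inner_smul_right]; positivity
    rw [← h1] at h3
    exact nonneg_of_mul_nonneg_right h3
      (div_pos (Nat.cast_pos.2 (hs.dim_pos i)) hδ)
  -- The growth is chained from xd to xd + δe (`t3`, `t4`) and on to z + δe (`t1`), with the slope
  -- at xd + δe bounded below by `t2`. The quadratic terms add up to (α/2)(a+δ)².
  have key : ∀ᵐ w ∂sphereLaw d, (1 + a / δ) * J w + α / 2 * (a + δ) ^ 2 ≤ 2 * M := by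
    filter_upwards [ae_sphereLaw hs.dim_pos] with w hw
    have hp := hs.add_smul_mem_prodSet (w := WithLp.toLp 2 w) hxd.1 fun j => (hw j).le
    set p : Profile d := xd + δ • WithLp.toLp 2 w with hpdef
    set h : EuclideanSpace ℝ (Fin (d i)) → ℝ := fun y => f i (deviate p i y) with hh
    have hJw : J w = (h (xd i + δ • e) - h (xd i - δ • e)) / 2 := by
      rw [hJ]
      simp only [toLp_update, add_smul_deviate]
      exact integral_unifSphere_of_dim_eq_one hi h (xd i) δ he1
    have hmem0 : xd i - δ • e ∈ X i := by
      have := hs.add_smul_mem (hxd.1 i) (u := -e) (by rw [norm_neg, he1])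
      rwa [smul_neg, ← sub_eq_add_neg] at this
    have hmem1 : xd i + δ • e ∈ X i := hs.add_smul_mem (hxd.1 i) he1.le
    have hmem2 : z + δ • e ∈ X i := hs.add_smul_mem hz he1.le
    have hmemm : xd i ∈ X i := hs.shrink_subset i (hxd.1 i)
    have t1 := hs.tangent_add_sq_le (deviate_mem hp hmem1) hmem2
    have t2 := hs.tangent_add_sq_le (deviate_mem hp hmem1) hmem0
    have t3 := hs.tangent_add_sq_le (deviate_mem hp hmemm) hmem1
    have t4 := hs.tangent_add_sq_le (deviate_mem hp hmemm) hmem0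
    have v1 : z + δ • e - (xd i + δ • e) = a • e := by rw [hze]; module
    have v2 : xd i - δ • e - (xd i + δ • e) = (-(2 * δ)) • e := by module
    have v3 : xd i + δ • e - xd i = δ • e := by module
    have v4 : xd i - δ • e - xd i = (-δ) • e := by module
    simp only [deviate_same, deviate_deviate, v1, v2, v3, v4, norm_smul, he1,
      real_inner_smul_right, norm_neg, mul_one, Real.norm_of_nonneg h0.le,
      Real.norm_eq_abs, sq_abs] at t1 t2 t3 t4
    have b1 := abs_le.1 (hs.abs_cost_le i (deviate_mem (i := i) hp hmem2))
    have b2 := abs_le.1 (hs.abs_cost_le i (deviate_mem (i := i) hp hmemm))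
    set g1 := inner ℝ (partialGrad X f i (deviate p i (xd i + δ • e))) e
    have hg1 : a / δ * J w + a * α * δ ≤ a * g1 := by
      have h5 : J w + α * δ ^ 2 ≤ δ * g1 := by
        rw [hJw]; simp only [hh]; nlinarith
      have h6 := mul_le_mul_of_nonneg_left h5 (div_pos h0 hδ).le
      have h7 : a / δ * (δ * g1) = a * g1 := by field_simp
      have h8 : a / δ * (α * δ ^ 2) = a * α * δ := by field_simp
      rw [mul_add, h7, h8] at h6
      exact h6
    have hD : J w + α / 2 * δ ^ 2 ≤ f i (deviate p i (xd i + δ • e)) - f i (deviate p i (xd i)) := by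
      rw [hJw]; simp only [hh]; nlinarith
    nlinarith
  have hint : Integrable (fun w => (1 + a / δ) * J w + α / 2 * (a + δ) ^ 2) (sphereLaw d) :=
    (hres.1.const_mul _).add (integrable_const _)
  have h1 := integral_mono_ae hint (integrable_const (2 * M)) key
  rw [integral_add (hres.1.const_mul _) (integrable_const _), integral_const_mul] at h1
  simp only [integral_const, probReal_univ, one_smul] at h1
  have h2 : 0 ≤ (1 + a / δ) * ∫ w, J w ∂sphereLaw d := by positivity
  -- This is (a+δ)² ≥ 4aδ, which turns (α/2)(a+δ)² ≤ 2M into αδa ≤ M.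
  have h3 := mul_nonneg hα.le (sq_nonneg (a - δ))
  nlinarith

end Smoothable

/-! ### The iteration and its one-step estimate -/

section Iterates

variable {n : ℕ} {d : Fin n → ℕ} {X : ∀ i : Fin n, Set (EuclideanSpace ℝ (Fin (d i)))}
  {f : Fin n → Profile d → ℝ} {α β L r R δ : ℝ}

theorem iterates_one (η : ℕ → ℝ) (x₁ : Profile d) (v : ℕ → Profile d) :
    iterates X f δ η x₁ v 1 = x₁ := by
  simp [iterates]

theorem iterates_succ (η : ℕ → ℝ) (x₁ : Profile d) (v : ℕ → Profile d) {t : ℕ} (ht : 1 ≤ t) :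
    iterates X f δ η x₁ v (t + 1) = step X f δ (η t) (iterates X f δ η x₁ v t) (v t) := by
  rw [iterates, if_neg (by omega)]

/-- The costs, set to zero outside the product of the strategy sets. -/
def truncCost (X : ∀ i : Fin n, Set (EuclideanSpace ℝ (Fin (d i)))) (f : Fin n → Profile d → ℝ)
    (i : Fin n) : Profile d → ℝ := (prodSet X).indicator (f i)

theorem Standing.metricProj_mem_shrink (hg : Standing X f α β L r R) (i : Fin n)
    (u : EuclideanSpace ℝ (Fin (d i))) : metricProj (shrink X δ i) u ∈ shrink X δ i :=
  (metricProj_spec ⟨0, hg.zero_mem_shrink i⟩ (hg.isClosed_shrink i) (hg.convex_shrink i) u).1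

theorem Standing.step_mem (hg : Standing X f α β L r R) (h : Fin n → Profile d → ℝ) (η : ℝ)
    (x v : Profile d) : step X h δ η x v ∈ prodSet (shrink X δ) :=
  fun i => hg.metricProj_mem_shrink i _

theorem Standing.iterates_mem (hg : Standing X f α β L r R) (h : Fin n → Profile d → ℝ)
    (η : ℕ → ℝ) {x₁ : Profile d} (hx₁ : x₁ ∈ prodSet (shrink X δ)) (v : ℕ → Profile d) (t : ℕ) :
    iterates X h δ η x₁ v t ∈ prodSet (shrink X δ) := by
  rcases t with _ | _ | t
  · simpa [iterates] using hx₁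
  · simpa [iterates] using hx₁
  · rw [iterates_succ _ _ _ (by omega)]
    exact hg.step_mem h _ _ _

theorem Smoothable.step_truncCost (hs : Smoothable X f α β L r R δ) (η : ℝ) {x v : Profile d}
    (hx : x ∈ prodSet (shrink X δ)) (hv : ∀ i, ‖v i‖ ≤ 1) :
    step X (truncCost X f) δ η x v = step X f δ η x v := by
  have h : ∀ i, truncCost X f i (x + δ • v) = f i (x + δ • v) := fun i =>
    Set.indicator_of_mem (hs.add_smul_mem_prodSet hx hv) _
  simp only [step, gradEstimate, h]

/-- With directions in the unit ball all queries stay in X, so truncation changes nothing. Its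
purpose is to make the iterates measurable, since the costs are measurable only on X. -/
theorem Smoothable.iterates_truncCost (hs : Smoothable X f α β L r R δ) (η : ℕ → ℝ)
    {x₁ : Profile d} (hx₁ : x₁ ∈ prodSet (shrink X δ)) {v : ℕ → Profile d}
    (hv : ∀ t i, ‖v t i‖ ≤ 1) (t : ℕ) :
    iterates X (truncCost X f) δ η x₁ v t = iterates X f δ η x₁ v t := by
  induction t with
  | zero => simp [iterates]
  | succ t ih =>
    rcases Nat.eq_zero_or_pos t with rfl | ht
    · simp [iterates]
    · rw [iterates_succ _ _ _ ht, iterates_succ _ _ _ ht, ih,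
        hs.step_truncCost _ (hs.iterates_mem f η hx₁ v t) (hv t)]

theorem Standing.measurable_step (hg : Standing X f α β L r R) (η : ℝ) {Ω : Type*}
    {m : MeasurableSpace Ω} {x v : Ω → Profile d} (hx : Measurable x) (hv : Measurable v) :
    Measurable fun ω => step X (truncCost X f) δ η (x ω) (v ω) := by
  refine (WithLp.measurable_toLp 2 _).comp (measurable_pi_iff.2 fun i => ?_)
  refine (continuous_metricProj ⟨0, hg.zero_mem_shrink i⟩ (hg.isClosed_shrink i)
    (hg.convex_shrink i)).measurable.comp ?_
  have h1 : Measurable fun ω => truncCost X f i (x ω + δ • v ω) :=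
    (hg.measurable_indicator_cost i).comp (hx.add (hv.const_smul δ))
  have h2 : Measurable fun ω => x ω i := by fun_prop
  have h3 : Measurable fun ω => v ω i := by fun_prop
  exact h2.sub (((h1.const_mul _).smul h3).const_smul η)

/-- After the projection is discarded, the square is expanded. The cross term averages to
⟨smoothGrad x, x - xd⟩, which is at least (α/2)‖x-xd‖² by strong monotonicity and the variational
inequality at xd. -/
theorem Smoothable.integral_norm_step_sub_sq_le (hs : Smoothable X f α β L r R δ) {η : ℝ}
    (hη : 0 ≤ η) {x xd : Profile d} (hx : x ∈ prodSet (shrink X δ))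
    (hxd : IsNash (shrink X δ) (smoothed f δ) xd) :
    ∫ w, ‖step X f δ η x (WithLp.toLp 2 w) - xd‖ ^ 2 ∂(sphereLaw d)
      ≤ (1 - η * α) * ‖x - xd‖ ^ 2
        + η ^ 2 * (Fstar X f * ((∑ i, d i : ℕ) : ℝ) ^ 2 / δ ^ 2) := by
  have := isProbabilityMeasure_sphereLaw hs.dim_pos
  have hδ := hs.delta_pos
  rw [hs.isNash_smoothed_iff] at hxd
  set S := Fstar X f * ((∑ i, d i : ℕ) : ℝ) ^ 2 / δ ^ 2 with hS
  set T : Fin n → (∀ j : Fin n, EuclideanSpace ℝ (Fin (d j))) → ℝ := fun i w =>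
    d i / δ * (f i (x + δ • WithLp.toLp 2 w) * inner ℝ (w i) (x i - xd i)) with hT
  have hTi : ∀ i, Integrable (T i) (sphereLaw d) := fun i =>
    (hs.integrable_cost_mul_inner i hx _).const_mul _
  have hpt : ∀ᵐ w ∂(sphereLaw d), ‖step X f δ η x (WithLp.toLp 2 w) - xd‖ ^ 2
      ≤ ‖x - xd‖ ^ 2 - 2 * η * (∑ i, T i w) + η ^ 2 * S := by
    filter_upwards [ae_sphereLaw hs.dim_pos] with w hw
    have hmem := hs.add_smul_mem_prodSet (w := WithLp.toLp 2 w) hx fun j => (hw j).le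
    have hi : ∀ i, ‖(step X f δ η x (WithLp.toLp 2 w) - xd) i‖ ^ 2
        ≤ ‖(x - xd) i‖ ^ 2 - 2 * η * T i w + η ^ 2 * ((d i : ℝ) ^ 2 * (Fstar X f / δ ^ 2)) := by
      intro i
      set g := gradEstimate f δ x (WithLp.toLp 2 w) i with hgdef
      have h1 : ‖(step X f δ η x (WithLp.toLp 2 w) - xd) i‖ ≤ ‖(x i - xd i) - η • g‖ := by
        have h2 := norm_metricProj_sub_le ⟨0, hs.zero_mem_shrink i⟩ (hs.isClosed_shrink i)
          (hs.convex_shrink i) (x i - η • g) (hxd.1 i)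
        rw [sub_right_comm] at h2
        exact h2
      refine (pow_le_pow_left₀ (norm_nonneg _) h1 2).trans ?_
      rw [norm_sub_sq_real, real_inner_smul_right, norm_smul, mul_pow, Real.norm_eq_abs, sq_abs]
      have h3 : inner ℝ (x i - xd i) g = T i w := by
        rw [hgdef, gradEstimate, real_inner_smul_right, real_inner_comm, hT]
        simp only
        ring
      have h4 : ‖g‖ ^ 2 ≤ (d i : ℝ) ^ 2 * (Fstar X f / δ ^ 2) := by
        have h5 : ‖g‖ = d i / δ * |f i (x + δ • WithLp.toLp 2 w)| := by
          rw [hgdef, gradEstimate, norm_smul, Real.norm_eq_abs, abs_mul,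
            abs_of_nonneg (by positivity)]
          simp [hw i]
        rw [h5, mul_pow, div_pow, div_mul_eq_mul_div, mul_div_assoc]
        have h6 := hs.cost_sq_le i hmem
        gcongr
      rw [h3, PiLp.sub_apply]
      have h7 := mul_le_mul_of_nonneg_left h4 (sq_nonneg η)
      linarith
    rw [Profile.norm_sq, Profile.norm_sq]
    refine (Finset.sum_le_sum fun i _ => hi i).trans ?_
    rw [Finset.sum_add_distrib, Finset.sum_sub_distrib, ← Finset.mul_sum, ← Finset.mul_sum,
      ← Finset.sum_mul]
    have h8 : ∑ i, (d i : ℝ) ^ 2 ≤ ((∑ i, d i : ℕ) : ℝ) ^ 2 := by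
      push_cast
      rw [pow_two (∑ i, (d i : ℝ)), Finset.sum_mul]
      refine Finset.sum_le_sum fun i hi => ?_
      rw [pow_two]
      exact mul_le_mul_of_nonneg_left (Finset.single_le_sum (f := fun i => (d i : ℝ))
        (fun j _ => Nat.cast_nonneg _) hi) (Nat.cast_nonneg _)
    have h9 : 0 ≤ Fstar X f / δ ^ 2 := div_nonneg Standing.Fstar_nonneg (by positivity)
    have h10 := mul_le_mul_of_nonneg_left (mul_le_mul_of_nonneg_right h8 h9) (sq_nonneg η)
    have h11 : ((∑ i, d i : ℕ) : ℝ) ^ 2 * (Fstar X f / δ ^ 2) = S := by rw [hS]; ring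
    rw [h11] at h10
    linarith
  have hTs : Integrable (fun w => ∑ i, T i w) (sphereLaw d) := integrable_finsetSum _ fun i _ => hTi i
  have hbi : Integrable (fun w => ‖x - xd‖ ^ 2 - 2 * η * (∑ i, T i w) + η ^ 2 * S) (sphereLaw d) :=
    ((integrable_const _).sub (hTs.const_mul _)).add (integrable_const _)
  refine (integral_mono_of_nonneg (.of_forall fun _ => by positivity) hbi hpt).trans ?_
  rw [integral_add (by exact (integrable_const _).sub (hTs.const_mul _)) (integrable_const _),
    integral_sub (integrable_const _) (hTs.const_mul _), integral_const_mul,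
    integral_finsetSum _ fun i _ => hTi i]
  have hsum : ∑ i, ∫ w, T i w ∂(sphereLaw d) = inner ℝ (smoothGrad X f δ x) (x - xd) := by
    rw [PiLp.inner_apply]
    refine Finset.sum_congr rfl fun i _ => ?_
    rw [hT]
    simp only
    rw [integral_const_mul, hs.integral_cost_mul_inner i hx]
    rfl
  rw [hsum]
  simp only [integral_const, probReal_univ, one_smul]
  have h1 := hs.strongly_monotone_smoothGrad x hx xd hxd.1
  have h2 := hxd.2 x hx
  rw [inner_sub_left] at h1
  have h3 : α / 2 * ‖x - xd‖ ^ 2 ≤ inner ℝ (smoothGrad X f δ x) (x - xd) := by linarith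
  have h4 := mul_le_mul_of_nonneg_left h3 (mul_nonneg zero_le_two hη)
  linarith

end Iterates

/-! ### Independence and the recursion for the mean square error -/

section Stochastic

variable {n : ℕ} {d : Fin n → ℕ} {X : ∀ i : Fin n, Set (EuclideanSpace ℝ (Fin (d i)))}
  {f : Fin n → Profile d → ℝ} {α β L r R δ : ℝ}
  {Ω : Type*}
  {v : ℕ → ∀ i : Fin n, Ω → EuclideanSpace ℝ (Fin (d i))}

/-- The sampled profiles. -/
def sample (v : ℕ → ∀ i : Fin n, Ω → EuclideanSpace ℝ (Fin (d i))) (ω : Ω) (t : ℕ) : Profile d :=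
  WithLp.toLp 2 fun i => v t i ω

/-- The σ-algebra generated by the directions sampled at the times in `S`. -/
@[reducible] def sampleAlgebra (v : ℕ → ∀ i : Fin n, Ω → EuclideanSpace ℝ (Fin (d i))) (S : Set ℕ) :
    MeasurableSpace Ω :=
  ⨆ p ∈ {p : ℕ × Fin n | p.1 ∈ S}, MeasurableSpace.comap (v p.1 p.2) inferInstance

theorem sampleAlgebra_mono {S T : Set ℕ} (h : S ⊆ T) : sampleAlgebra v S ≤ sampleAlgebra v T :=
  biSup_mono fun _ hp => h hp

theorem measurable_sample {S : Set ℕ} {t : ℕ} (ht : t ∈ S) :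
    Measurable[sampleAlgebra v S] fun ω => sample v ω t := by
  refine (WithLp.measurable_toLp 2 _).comp (@measurable_pi_iff _ _ _ (sampleAlgebra v S) _ _ |>.2
    fun i => ?_)
  refine Measurable.mono (comap_measurable (v t i)) ?_ le_rfl
  exact le_biSup (fun p : ℕ × Fin n => MeasurableSpace.comap (v p.1 p.2) inferInstance)
    (show (t, i) ∈ {p : ℕ × Fin n | p.1 ∈ S} from ht)

/-- Only directions drawn strictly before t enter x^t, which is what makes it independent of the
directions at time t. -/
theorem Standing.measurable_iterates (hg : Standing X f α β L r R) (η : ℕ → ℝ) (x₁ : Profile d)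
    (t : ℕ) : Measurable[sampleAlgebra v (Set.Iio t)]
      fun ω => iterates X (truncCost X f) δ η x₁ (sample v ω) t := by
  induction t with
  | zero => exact @measurable_const _ _ _ (sampleAlgebra v _) _
  | succ t ih =>
    rcases Nat.eq_zero_or_pos t with rfl | ht
    · simp only [zero_add, iterates_one]
      exact @measurable_const _ _ _ (sampleAlgebra v _) _
    · simp only [iterates_succ _ _ _ ht]
      have h1 : Measurable[sampleAlgebra v (Set.Iio (t + 1))]
          fun ω => iterates X (truncCost X f) δ η x₁ (sample v ω) t :=
        ih.mono (sampleAlgebra_mono (Set.Iio_subset_Iio (Nat.le_succ t))) le_rfl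
      have h2 : Measurable[sampleAlgebra v (Set.Iio (t + 1))] fun ω => sample v ω t :=
        measurable_sample (Nat.lt_succ_self t)
      exact hg.measurable_step (η t) h1 h2

variable [mΩ : MeasurableSpace Ω] {P : Measure Ω}

theorem sampleAlgebra_le (hv : ∀ t i, Measurable (v t i)) (S : Set ℕ) : sampleAlgebra v S ≤ mΩ :=
  iSup₂_le fun p _ => (hv p.1 p.2).comap_le

theorem indep_sampleAlgebra (hv : ∀ t i, Measurable (v t i))
    (hind : iIndepFun (fun p : ℕ × Fin n => v p.1 p.2) P) {S T : Set ℕ} (h : Disjoint S T) :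
    Indep (sampleAlgebra v S) (sampleAlgebra v T) P :=
  indep_iSup_of_disjoint (m := fun p : ℕ × Fin n => MeasurableSpace.comap (v p.1 p.2) inferInstance)
    (fun p => (hv p.1 p.2).comap_le) hind
    (h.preimage (Prod.fst : ℕ × Fin n → ℕ))

theorem map_sample (hv : ∀ t i, Measurable (v t i))
    (hind : iIndepFun (fun p : ℕ × Fin n => v p.1 p.2) P)
    (hlaw : ∀ t i, P.map (v t i) = unifSphere (d i)) (t : ℕ) :
    P.map (fun ω i => v t i ω) = sphereLaw d := by
  have h1 : iIndepFun (fun i => v t i) P :=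
    hind.precomp (g := fun i => (t, i)) fun i j h => (Prod.mk.inj h).2
  rw [h1.map_fun_eq_pi_map fun i => (hv t i).aemeasurable, sphereLaw]
  simp only [hlaw]

variable [IsProbabilityMeasure P]

/-- By independence the joint law of x^t and the new directions is a product, so Fubini replaces
conditioning and the one-step estimate applies at each fixed position. -/
theorem Smoothable.integral_iterates_succ_le (hs : Smoothable X f α β L r R δ)
    (hv : ∀ t i, Measurable (v t i))
    (hind : iIndepFun (fun p : ℕ × Fin n => v p.1 p.2) P)
    (hlaw : ∀ t i, P.map (v t i) = unifSphere (d i)) {η : ℕ → ℝ} (hη : ∀ t, 0 ≤ η t)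
    {x₁ xd : Profile d} (hx₁ : x₁ ∈ prodSet (shrink X δ))
    (hxd : IsNash (shrink X δ) (smoothed f δ) xd) {t : ℕ} (ht : 1 ≤ t) :
    ∫ ω, ‖iterates X (truncCost X f) δ η x₁ (sample v ω) (t + 1) - xd‖ ^ 2 ∂P
      ≤ (1 - η t * α) *
          ∫ ω, ‖iterates X (truncCost X f) δ η x₁ (sample v ω) t - xd‖ ^ 2 ∂P
        + η t ^ 2 * (Fstar X f * ((∑ i, d i : ℕ) : ℝ) ^ 2 / δ ^ 2) := by
  have := isProbabilityMeasure_sphereLaw hs.dim_pos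
  set x : Ω → Profile d := fun ω => iterates X (truncCost X f) δ η x₁ (sample v ω) t with hx
  set W : Ω → ∀ i, EuclideanSpace ℝ (Fin (d i)) := fun ω i => v t i ω with hW
  have hxm' : Measurable[sampleAlgebra v (Set.Iio t)] x := hs.measurable_iterates η x₁ t
  have hxm : Measurable x := hxm'.mono (sampleAlgebra_le hv _) le_rfl
  have hWm : Measurable W := measurable_pi_iff.2 fun i => hv t i
  have hWm' : Measurable[sampleAlgebra v {t}] W :=
    (WithLp.measurable_ofLp 2 _).comp (measurable_sample (v := v) (Set.mem_singleton t))
  have hindep : IndepFun x W P := by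
    have h1 := indep_sampleAlgebra hv hind (S := Set.Iio t) (T := {t}) (by simp)
    exact indep_of_indep_of_le_left (indep_of_indep_of_le_right h1 hWm'.comap_le) hxm'.comap_le
  set Φ : Profile d × (∀ i, EuclideanSpace ℝ (Fin (d i))) → ℝ := fun p =>
    ‖step X (truncCost X f) δ (η t) p.1 (WithLp.toLp 2 p.2) - xd‖ ^ 2 with hΦ
  have hΦm : Measurable Φ := by
    have h1 : Measurable fun p : Profile d × (∀ i, EuclideanSpace ℝ (Fin (d i))) =>
        step X (truncCost X f) δ (η t) p.1 (WithLp.toLp 2 p.2) :=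
      hs.measurable_step (η t) measurable_fst
        ((WithLp.measurable_toLp 2 _).comp measurable_snd)
    exact ((h1.sub_const xd).norm).pow_const 2
  have hbound : ∀ y ∈ prodSet (shrink X δ), ‖y - xd‖ ^ 2 ≤ (R + R) ^ 2 := fun y hy =>
    hs.norm_sub_sq_le_const (hs.prodSet_shrink_subset hy) (hs.prodSet_shrink_subset hxd.1)
  have hmap : P.map (fun ω => (x ω, W ω)) = (P.map x).prod (sphereLaw d) := by
    rw [hindep.map_prod_eq_prod_map_map hxm.aemeasurable hWm.aemeasurable, map_sample hv hind hlaw]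
  have := Measure.isProbabilityMeasure_map (μ := P) hxm.aemeasurable
  have hΦi : Integrable Φ ((P.map x).prod (sphereLaw d)) := by
    refine Integrable.of_bound (C := (R + R) ^ 2) hΦm.aestronglyMeasurable (.of_forall fun p => ?_)
    rw [Real.norm_of_nonneg (by positivity)]
    exact hbound _ (hs.step_mem _ _ _ _)
  have hae : ∀ᵐ y ∂(P.map x), y ∈ prodSet (shrink X δ) := by
    have hK : MeasurableSet (prodSet (shrink X δ)) :=
      (isClosed_prodSet fun i => hs.isClosed_shrink i).measurableSet
    exact (ae_map_iff hxm.aemeasurable hK).2 (.of_forall fun ω => hs.iterates_mem _ _ hx₁ _ _)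
  have hqm : Measurable fun y : Profile d => ‖y - xd‖ ^ 2 := by fun_prop
  have hqi : Integrable (fun y : Profile d => ‖y - xd‖ ^ 2) (P.map x) := by
    refine Integrable.of_bound (C := (R + R) ^ 2) hqm.aestronglyMeasurable ?_
    filter_upwards [hae] with y hy
    rw [Real.norm_of_nonneg (by positivity)]
    exact hbound _ hy
  calc ∫ ω, ‖iterates X (truncCost X f) δ η x₁ (sample v ω) (t + 1) - xd‖ ^ 2 ∂P
      = ∫ ω, Φ (x ω, W ω) ∂P := by
        simp only [iterates_succ _ _ _ ht]
        rfl
    _ = ∫ y, ∫ w, Φ (y, w) ∂(sphereLaw d) ∂(P.map x) := by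
        rw [← integral_prod _ hΦi, ← hmap,
          integral_map (hxm.prodMk hWm).aemeasurable hΦm.aestronglyMeasurable]
    _ ≤ ∫ y, ((1 - η t * α) * ‖y - xd‖ ^ 2
          + η t ^ 2 * (Fstar X f * ((∑ i, d i : ℕ) : ℝ) ^ 2 / δ ^ 2)) ∂(P.map x) := by
        refine integral_mono_ae hΦi.integral_prod_left
          ((hqi.const_mul _).add (integrable_const _)) ?_
        filter_upwards [hae] with y hy
        refine le_trans (le_of_eq ?_) (hs.integral_norm_step_sub_sq_le (hη t) hy hxd)
        refine integral_congr_ae ?_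
        filter_upwards [ae_sphereLaw hs.dim_pos] with w hw
        rw [hΦ]
        simp only
        rw [hs.step_truncCost _ hy fun i => (hw i).le]
    _ = _ := by
        rw [integral_add (hqi.const_mul _) (integrable_const _), integral_const_mul,
          integral_map hxm.aemeasurable hqm.aestronglyMeasurable]
        simp only [integral_const, probReal_univ, one_smul, hx]

end Stochastic

/-! ### Solving the recursion -/

section Rate

/-- The rate given by the recursion with contraction factor `1 - 2 / t`. -/
theorem rate_of_recursion {e : ℕ → ℝ} {Q : ℝ} (he : ∀ t, 0 ≤ e t)
    (hrec : ∀ t : ℕ, 1 ≤ t → e (t + 1) ≤ (1 - 2 / t) * e t + Q / t ^ 2) :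
    e 2 ≤ Q ∧ ∀ t : ℕ, 3 ≤ t → e t ≤ Q / t := by
  have h2 : e 2 ≤ Q := by
    -- At t = 1 the factor 1 - 2/t is -1, so the nonnegative term e 1 can be dropped.
    have := hrec 1 le_rfl
    norm_num at this
    linarith [he 1]
  have hQ : 0 ≤ Q := (he 2).trans h2
  refine ⟨h2, fun t ht => ?_⟩
  induction t, ht using Nat.le_induction with
  | base =>
    -- At t = 2 the factor vanishes, so e 3 ≤ Q/4 ≤ Q/3 whatever e 2 is.
    have := hrec 2 (by norm_num)
    norm_num at this ⊢
    linarith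
  | succ t ht ih =>
    have ht' : (3 : ℝ) ≤ t := by exact_mod_cast ht
    have h1 : 0 ≤ 1 - 2 / (t : ℝ) := by
      rw [sub_nonneg, div_le_one (by linarith)]; linarith
    refine (hrec t (by omega)).trans ?_
    have h3 := mul_le_mul_of_nonneg_left ih h1
    refine (add_le_add_left h3 _).trans ?_
    have h4 : (1 - 2 / (t : ℝ)) * (Q / t) + Q / t ^ 2 = Q * ((t - 1) / t ^ 2) := by
      field_simp; ring
    rw [h4]
    push_cast
    rw [div_eq_mul_one_div Q]
    refine mul_le_mul_of_nonneg_left ?_ hQ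
    -- The induction closes because (t-1)(t+1) ≤ t².
    rw [div_le_div_iff₀ (by positivity) (by positivity)]
    nlinarith

end Rate

/-! ### Small times -/

namespace Smoothable

variable {n : ℕ} {d : Fin n → ℕ} {X : ∀ i : Fin n, Set (EuclideanSpace ℝ (Fin (d i)))}
  {f : Fin n → Profile d → ℝ} {α β L r R δ : ℝ}

theorem norm_sub_sq_le (hs : Smoothable X f α β L r R δ) {x y : Profile d}
    (hx : x ∈ prodSet (shrink X δ)) (hy : y ∈ prodSet (shrink X δ)) :
    δ ^ 2 * α ^ 2 * ‖x - y‖ ^ 2 ≤ 4 * Fstar X f * n := by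
  have hα := hs.alpha_pos
  have hδ := hs.delta_pos
  have h : ∀ i, δ ^ 2 * α ^ 2 * ‖(x - y) i‖ ^ 2 ≤ 4 * Fstar X f := by
    intro i
    have h1 := pow_le_pow_left₀ (by positivity) (hs.norm_sub_le_sqrt_Fstar (hx i) (hy i)) 2
    rw [mul_pow, mul_pow 2, Real.sq_sqrt Standing.Fstar_nonneg] at h1
    rw [PiLp.sub_apply]
    linarith
  rw [Profile.norm_sq, Finset.mul_sum]
  refine (Finset.sum_le_sum fun i _ => h i).trans_eq ?_
  simp [mul_comm]

/-- From dimension two on, the diameter bound suffices because 4 ≤ d²; dimension one uses the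
equilibrium estimate. -/
theorem norm_sub_equilibrium_sq_le (hs : Smoothable X f α β L r R δ) (hn : n = 1)
    {x xd : Profile d} (hx : x ∈ prodSet (shrink X δ))
    (hxd : IsNash (shrink X δ) (smoothed f δ) xd) :
    δ ^ 2 * α ^ 2 * ‖x - xd‖ ^ 2 ≤ Fstar X f * ((∑ i, d i : ℕ) : ℝ) ^ 2 := by
  subst hn
  have hF : 0 ≤ Fstar X f := Standing.Fstar_nonneg
  have hα := hs.alpha_pos
  have hδ := hs.delta_pos
  rw [Fin.sum_univ_one]
  rcases (Nat.succ_le_of_lt (hs.dim_pos 0)).eq_or_lt with h1 | h2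
  · have h3 := pow_le_pow_left₀ (by positivity)
      (hs.norm_sub_equilibrium_le_of_dim_eq_one h1.symm hxd (hx 0)) 2
    rw [mul_pow, mul_pow, Real.sq_sqrt hF] at h3
    rw [Profile.norm_sq, Fin.sum_univ_one, PiLp.sub_apply]
    have h4 : (d 0 : ℝ) = 1 := by exact_mod_cast h1.symm
    simp only [h4]
    linarith
  · refine (hs.norm_sub_sq_le hx hxd.1).trans ?_
    have h3 : (2 : ℝ) ≤ d 0 := by exact_mod_cast h2
    have h4 := mul_le_mul_of_nonneg_left (pow_le_pow_left₀ zero_le_two h3 2) hF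
    norm_num at h4 ⊢
    linarith

/-- The target is e t ≤ Qn/t. For t ≥ 3 it is the recursion and for t = 1 the diameter bound. At t =
2 the bound e 2 ≤ Q is short by a factor 2, which n ≥ 2 absorbs; `he2` covers n = 1. -/
theorem two_mul_le_rate (hs : Smoothable X f α β L r R δ) (hn : 0 < n) {x₁ xd : Profile d}
    (hx₁ : x₁ ∈ prodSet (shrink X δ)) (hxd : IsNash (shrink X δ) (smoothed f δ) xd) {e : ℕ → ℝ}
    (he : ∀ t, 0 ≤ e t) (he1 : e 1 = ‖x₁ - xd‖ ^ 2)
    (he2 : n = 1 → δ ^ 2 * α ^ 2 * e 2 ≤ Fstar X f * ((∑ i, d i : ℕ) : ℝ) ^ 2)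
    (hrec : ∀ t : ℕ, 1 ≤ t → e (t + 1) ≤ (1 - 2 / t) * e t
      + 4 * Fstar X f * ((∑ i, d i : ℕ) : ℝ) ^ 2 / (δ ^ 2 * α ^ 2) / t ^ 2) {t : ℕ} (ht : 1 ≤ t) :
    2 * e t ≤ 8 * Fstar X f * ((∑ i, d i : ℕ) : ℝ) ^ 2 * n / (δ ^ 2 * α ^ 2 * t) := by
  obtain ⟨hr2, hr3⟩ := rate_of_recursion he hrec
  have hF : 0 ≤ Fstar X f := Standing.Fstar_nonneg
  have hα := hs.alpha_pos
  have hδ := hs.delta_pos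
  set c := δ ^ 2 * α ^ 2 with hc
  have hcpos : 0 < c := by positivity
  set D : ℝ := ((∑ i, d i : ℕ) : ℝ) with hD
  have hn1 : (1 : ℝ) ≤ n := by exact_mod_cast hn
  have hD1 : 1 ≤ D := by
    rw [hD]
    have h1 : d ⟨0, hn⟩ ≤ ∑ i, d i := Finset.single_le_sum (fun _ _ => Nat.zero_le _)
      (Finset.mem_univ _)
    exact_mod_cast (hs.dim_pos ⟨0, hn⟩).trans_le h1
  have hFD : 0 ≤ Fstar X f * D ^ 2 := by positivity
  have ht0 : (0 : ℝ) < t := by exact_mod_cast ht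
  rw [le_div_iff₀ (by positivity)]
  rcases Nat.lt_or_ge t 3 with h3 | h3
  · interval_cases t
    · have h4 := hs.norm_sub_sq_le hx₁ hxd.1
      rw [← he1] at h4
      have h5 : Fstar X f * n ≤ Fstar X f * n * D ^ 2 :=
        le_mul_of_one_le_right (by positivity) (one_le_pow₀ hD1)
      push_cast
      linarith
    · rw [le_div_iff₀ hcpos] at hr2
      push_cast
      rcases (show 1 ≤ n from hn).eq_or_lt with h4 | h4
      · have h5 := he2 h4.symm
        have h6 := mul_le_mul_of_nonneg_left hn1 hFD
        linarith
      · have h5 : (2 : ℝ) ≤ n := by exact_mod_cast h4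
        have h6 := mul_le_mul_of_nonneg_left h5 hFD
        linarith
  · have h4 := hr3 t h3
    rw [div_div, le_div_iff₀ (by positivity)] at h4
    have h6 := mul_le_mul_of_nonneg_left hn1 hFD
    linarith

end Smoothable

/-! ### The mean square error -/

namespace Smoothable

variable {n : ℕ} {d : Fin n → ℕ} {X : ∀ i : Fin n, Set (EuclideanSpace ℝ (Fin (d i)))}
  {f : Fin n → Profile d → ℝ} {α β L r R δ : ℝ}
  {Ω : Type*} [MeasurableSpace Ω] {P : Measure Ω} [IsProbabilityMeasure P]
  {v : ℕ → ∀ i : Fin n, Ω → EuclideanSpace ℝ (Fin (d i))}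

theorem two_mul_integral_iterates_le (hs : Smoothable X f α β L r R δ)
    (hv : ∀ t i, Measurable (v t i)) (hind : iIndepFun (fun p : ℕ × Fin n => v p.1 p.2) P)
    (hlaw : ∀ t i, P.map (v t i) = unifSphere (d i)) {x₁ xd : Profile d}
    (hx₁ : x₁ ∈ prodSet (shrink X δ)) (hxd : IsNash (shrink X δ) (smoothed f δ) xd)
    {t : ℕ} (ht : 1 ≤ t) :
    2 * ∫ ω, ‖iterates X (truncCost X f) δ (fun s => 2 / (α * s)) x₁ (sample v ω) t - xd‖ ^ 2 ∂P
      ≤ 8 * Fstar X f * ((∑ i, d i : ℕ) : ℝ) ^ 2 * n / (δ ^ 2 * α ^ 2 * t) := by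
  have hα := hs.alpha_pos
  have hδ := hs.delta_pos
  -- Without players the profile space is trivial and both sides vanish.
  rcases Nat.eq_zero_or_pos n with rfl | hn
  · have h0 : ∀ x : Profile d, ‖x‖ ^ 2 = 0 := fun x => by rw [Profile.norm_sq]; simp
    simp [h0]
  refine hs.two_mul_le_rate hn hx₁ hxd (e := fun t => ∫ ω,
    ‖iterates X (truncCost X f) δ (fun s => 2 / (α * s)) x₁ (sample v ω) t - xd‖ ^ 2 ∂P)
    (fun t => integral_nonneg fun ω => by positivity) ?_ ?_ ?_ ht
  · simp [iterates_one]
  · intro hn1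
    rw [← integral_const_mul]
    refine (integral_mono_of_nonneg (.of_forall fun ω => by positivity) (integrable_const _)
      (.of_forall fun ω => hs.norm_sub_equilibrium_sq_le hn1
        (hs.iterates_mem _ _ hx₁ _ _) hxd)).trans_eq (by simp)
  · intro t ht
    refine (hs.integral_iterates_succ_le hv hind hlaw (η := fun s : ℕ => 2 / (α * s))
      (fun s => by positivity) hx₁ hxd ht).trans_eq ?_
    have ht0 : (t : ℝ) ≠ 0 := by exact_mod_cast (Nat.one_le_iff_ne_zero.1 ht)
    have e1 : 1 - 2 / (α * t) * α = 1 - 2 / (t : ℝ) := by field_simp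
    have e2 : (2 / (α * t)) ^ 2 * (Fstar X f * ((∑ i, d i : ℕ) : ℝ) ^ 2 / δ ^ 2)
        = 4 * Fstar X f * ((∑ i, d i : ℕ) : ℝ) ^ 2 / (δ ^ 2 * α ^ 2) / (t : ℝ) ^ 2 := by
      field_simp
      ring
    simp only [e1, e2]

theorem integrable_and_integral_iterates_le (hs : Smoothable X f α β L r R δ)
    (hv : ∀ t i, Measurable (v t i)) (hind : iIndepFun (fun p : ℕ × Fin n => v p.1 p.2) P)
    (hlaw : ∀ t i, P.map (v t i) = unifSphere (d i)) {x₁ xs xd : Profile d}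
    (hx₁ : x₁ ∈ prodSet (shrink X δ)) (hxs : IsNash X f xs)
    (hxd : IsNash (shrink X δ) (smoothed f δ) xd) {t : ℕ} (ht : 1 ≤ t) :
    Integrable (fun ω => ‖iterates X (truncCost X f) δ (fun s => 2 / (α * s)) x₁
      (sample v ω) t - xs‖ ^ 2) P ∧
    ∫ ω, ‖iterates X (truncCost X f) δ (fun s => 2 / (α * s)) x₁ (sample v ω) t - xs‖ ^ 2 ∂P
      ≤ max (δ ^ 2 * α ^ 2 * ‖x₁ - xd‖ ^ 2)
            (8 * Fstar X f * ((∑ i, d i : ℕ) : ℝ) ^ 2 * n) / (δ ^ 2 * α ^ 2 * t)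
        + 2 * δ ^ 2 * ((1 + β * Real.sqrt n / α) * ‖xs‖ + β * n / α) ^ 2 := by
  set x : Ω → Profile d := fun ω =>
    iterates X (truncCost X f) δ (fun s => 2 / (α * s)) x₁ (sample v ω) t with hx
  have hxm : Measurable x :=
    (hs.measurable_iterates (v := v) _ x₁ t).mono (sampleAlgebra_le hv _) le_rfl
  have hmem : ∀ ω, x ω ∈ prodSet X := fun ω =>
    hs.prodSet_shrink_subset (hs.iterates_mem _ _ hx₁ _ _)
  have hint : ∀ y ∈ prodSet X, Integrable (fun ω => ‖x ω - y‖ ^ 2) P := by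
    intro y hy
    refine Integrable.of_bound (C := (R + R) ^ 2)
      ((hxm.sub_const y).norm.pow_const 2).aestronglyMeasurable (.of_forall fun ω => ?_)
    rw [Real.norm_of_nonneg (by positivity)]
    exact hs.norm_sub_sq_le_const (hmem ω) hy
  have hid := hint xd (hs.prodSet_shrink_subset hxd.1)
  refine ⟨hint xs hxs.1, ?_⟩
  have h1 : ∫ ω, ‖x ω - xs‖ ^ 2 ∂P ≤ 2 * (∫ ω, ‖x ω - xd‖ ^ 2 ∂P) + 2 * ‖xd - xs‖ ^ 2 := by
    have h2 : ∫ ω, (2 * ‖x ω - xd‖ ^ 2 + 2 * ‖xd - xs‖ ^ 2) ∂P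
        = 2 * (∫ ω, ‖x ω - xd‖ ^ 2 ∂P) + 2 * ‖xd - xs‖ ^ 2 := by
      rw [integral_add (hid.const_mul _) (integrable_const _), integral_const_mul]
      simp
    rw [← h2]
    refine integral_mono (hint xs hxs.1) ((hid.const_mul _).add (integrable_const _)) fun ω => ?_
    have h3 := pow_le_pow_left₀ (norm_nonneg _)
      (norm_sub_le_norm_sub_add_norm_sub (x ω) xd xs) 2
    have h4 := sq_nonneg (‖x ω - xd‖ - ‖xd - xs‖)
    simp only
    linarith
  have h5 := hs.two_mul_integral_iterates_le hv hind hlaw hx₁ hxd ht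
  have h6 := pow_le_pow_left₀ (norm_nonneg _) (hs.norm_equilibrium_sub_le hxs hxd) 2
  have h7 : 8 * Fstar X f * ((∑ i, d i : ℕ) : ℝ) ^ 2 * n / (δ ^ 2 * α ^ 2 * t)
      ≤ max (δ ^ 2 * α ^ 2 * ‖x₁ - xd‖ ^ 2)
            (8 * Fstar X f * ((∑ i, d i : ℕ) : ℝ) ^ 2 * n) / (δ ^ 2 * α ^ 2 * t) := by
    have := hs.alpha_pos
    have := hs.delta_pos
    gcongr
    exact le_max_right _ _
  rw [mul_pow] at h6
  linarith

end Smoothable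

end DFGame

end

/-! ### The theorem -/

theorem mainTheorem1 {n : ℕ} {d : Fin n → ℕ} (hd : ∀ i, 0 < d i)
    (X : ∀ i : Fin n, Set (EuclideanSpace ℝ (Fin (d i))))
    (f : Fin n → DFGame.Profile d → ℝ) (α β L r R : ℝ)
    (hgame : DFGame.Standing X f α β L r R)
    (δ : ℝ) (hδ_pos : 0 < δ) (hδ_one : δ ≤ 1) (hδ_r : δ ≤ r)
    (hδ_L : 2 * L * (n : ℝ) ^ (3 / 2 : ℝ) * δ ≤ α)
    -- the queried strategies `x_i + δ v_i` are feasible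
    (hquery : ∀ i, ∀ y ∈ (1 - δ) • X i, ∀ u ∈ sphere (0 : EuclideanSpace ℝ (Fin (d i))) 1,
      y + δ • u ∈ X i)
    (x₁ : DFGame.Profile d) (hx₁ : x₁ ∈ DFGame.prodSet (fun i => (1 - δ) • X i))
    {Ω : Type*} [MeasurableSpace Ω] (P : Measure Ω) [IsProbabilityMeasure P]
    (v : ℕ → ∀ i : Fin n, Ω → EuclideanSpace ℝ (Fin (d i)))
    (hv_law : ∀ t i, HasLaw (v t i) (DFGame.unifSphere (d i)) P)
    (hv_indep : iIndepFun (fun p : ℕ × Fin n => v p.1 p.2) P) :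
    (∃! xs, DFGame.IsNash X f xs) ∧
    (∃! xd, DFGame.IsNash (fun i => (1 - δ) • X i) (DFGame.smoothed f δ) xd) ∧
    ∀ xs xd, DFGame.IsNash X f xs →
      DFGame.IsNash (fun i => (1 - δ) • X i) (DFGame.smoothed f δ) xd →
      ∀ t : ℕ, 1 ≤ t →
        Integrable (fun ω => ‖DFGame.iterates X f δ (fun s => 2 / (α * s)) x₁
          (fun s => WithLp.toLp 2 (fun i => v s i ω)) t - xs‖ ^ 2) P ∧
        ∫ ω, ‖DFGame.iterates X f δ (fun s => 2 / (α * s)) x₁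
          (fun s => WithLp.toLp 2 (fun i => v s i ω)) t - xs‖ ^ 2 ∂P
          ≤ max (δ ^ 2 * α ^ 2 * ‖x₁ - xd‖ ^ 2)
                (8 * DFGame.Fstar X f * ((∑ i, d i : ℕ) : ℝ) ^ 2 * n) / (δ ^ 2 * α ^ 2 * t)
            + 2 * δ ^ 2 * ((1 + β * Real.sqrt n / α) * ‖xs‖ + β * n / α) ^ 2 := by
  have hs : DFGame.Smoothable X f α β L r R δ :=
    { toStanding := hgame, dim_pos := hd, delta_pos := hδ_pos, delta_le_one := hδ_one,
      delta_small := hδ_L, query := hquery }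
  refine ⟨hgame.existsUnique_isNash, hs.existsUnique_isNash_smoothed, ?_⟩
  intro xs xd hxs hxd t ht
  -- `HasLaw` gives only almost everywhere measurable directions, while the generated σ-algebras
  -- need measurable ones. There are countably many, so the modifications agree with them
  -- simultaneously almost surely.
  obtain ⟨v', hvm, hvv⟩ : ∃ v' : ℕ → ∀ i : Fin n, Ω → EuclideanSpace ℝ (Fin (d i)),
      (∀ t i, Measurable (v' t i)) ∧ ∀ t i, v t i =ᵐ[P] v' t i :=
    ⟨fun t i => (hv_law t i).aemeasurable.mk (v t i),
      fun t i => (hv_law t i).aemeasurable.measurable_mk,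
      fun t i => (hv_law t i).aemeasurable.ae_eq_mk⟩
  have heq : ∀ᵐ ω ∂P, ∀ t i, v t i ω = v' t i ω :=
    ae_all_iff.2 fun t => ae_all_iff.2 fun i => hvv t i
  have hlaw : ∀ t i, P.map (v' t i) = DFGame.unifSphere (d i) := fun t i => by
    rw [← Measure.map_congr (hvv t i), (hv_law t i).map_eq]
  have hind : iIndepFun (fun p : ℕ × Fin n => v' p.1 p.2) P :=
    hv_indep.congr fun p => hvv p.1 p.2
  have hnorm : ∀ᵐ ω ∂P, ∀ t i, ‖v' t i ω‖ = 1 :=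
    ae_all_iff.2 fun t => ae_all_iff.2 fun i =>
      ae_of_ae_map (hvm t i).aemeasurable ((hlaw t i).symm ▸ DFGame.ae_unifSphere (d i))
  obtain ⟨h1, h2⟩ := hs.integrable_and_integral_iterates_le hvm hind hlaw hx₁ hxs hxd ht
  -- Almost surely all directions have norm 1, so the truncated iteration is the given one.
  have hiter : (fun ω => ‖DFGame.iterates X (DFGame.truncCost X f) δ (fun s => 2 / (α * s)) x₁
        (DFGame.sample v' ω) t - xs‖ ^ 2)
      =ᵐ[P] fun ω => ‖DFGame.iterates X f δ (fun s => 2 / (α * s)) x₁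
        (fun s => WithLp.toLp 2 (fun i => v s i ω)) t - xs‖ ^ 2 := by
    filter_upwards [heq, hnorm] with ω hω hω'
    have h3 : (fun s => WithLp.toLp 2 (fun i => v s i ω)) = DFGame.sample v' ω := by
      funext s
      simp only [DFGame.sample, hω]
    have h4 : ∀ s i, ‖DFGame.sample v' ω s i‖ ≤ 1 := fun s i => (hω' s i).le
    rw [h3, hs.iterates_truncCost _ hx₁ h4]
  exact ⟨h1.congr hiter, (integral_congr_ae hiter) ▸ h2⟩
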